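/- Let $d\ge1$, let $D\subset\mathbb R^d$ be a bounded open set and let $V=H^1_0(D)$ (real valued), the $H^1$-closure of $C_c^\infty(D)$, with norm $\|v\|_V=\|\nabla v\|_{L^2(D)}$ and dual $V^*$. Let $\alpha\in\mathbb N=\{1,2,\dots\}$, let $a_0\in L^\infty(D)$ and $a_{0,\min}>0$ with $a_0(x)\ge a_{0,\min}$ for a.e. $x\in D$, let $\phi_j:D\to\mathbb R$ $(j\ge1)$ be measurable, let $0<b_j\le1$ for all $j\ge 1$, and assume $$0<\kappa:=\Big\|\frac{\sum_{j\ge1}|\phi_j|/b_j}{2a_0}\Big\|_{L^\infty(D)}<\frac1{2\alpha+1}.$$ Put $\Omega=[-\tfrac12,\tfrac12]$, $a(x,y)=a_0(x)+\sum_{j\ge1}y_j\phi_j(x)$ for $y\in\Omega^{\mathbb N}$, and let $f,G\in V^*$. For every $y\in\Omega^{\mathbb N}$ there is a unique $u(\cdot,y)\in V$ with $\int_D a(x,y)\,\nabla u(x,y)\cdot\nabla v(x)\,dx=f(v)$ for all $v\in V$. For finite $\mathfrak u\subset\mathbb N$ let $y_{\mathfrak u}$ be $y$ with all coordinates outside $\mathfrak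 u$ replaced by $0$, let $$u_{\mathfrak u}(\cdot,y_{\mathfrak u})=\sum_{\mathfrak v\subseteq\mathfrak u}(-1)^{|\mathfrak u|-|\mathfrak v|}u(\cdot,y_{\mathfrak v})$$ be the terms of the decomposition anchored at $0$, and regard $G(u_{\mathfrak u})$ as a function on $\Omega^{\mathfrak u}$. Let $H_\alpha$ be the Hilbert space of functions $F$ on $\Omega$ with $F(0)=0$ and inner product $\sum_{r=1}^{\alpha-1}F^{(r)}(0)\tilde F^{(r)}(0)+\int_{-1/2}^{1/2}F^{(\alpha)}\tilde F^{(\alpha)}$, i.e. the reproducing kernel Hilbert space with kernel $$K_\alpha(x,y)=\sum_{r=1}^{\alpha-1}\frac{x^ry^r}{r!\,r!}+\int_0^{1/2}\frac{(x-t)_+^{\alpha-1}(y-t)_+^{\alpha-1}}{((\alpha-1)!)^2}\,dt+\int_{-1/2}^0\frac{(t-x)_+^{\alpha-1}(t-y)_+^{\alpha-1}}{((\alpha-1)!)^2}\,dt,$$ where $(s)_+^{0}=\mathbf 1_{s>0}$, and let $H_{\alpha,\mathfrak u}$ be the reproducing kernel Hilbert space on $\Omega^{\mathfrak u}$ with kernel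 $\prod_{j\in\mathfrak u}K_\alpha(x_j,y_j)$ (the constants, if $\mathfrak u=\emptyset$). Then for every finite $\mathfrak u\subset\mathbb N$ the function $G(u_{\mathfrak u})$ belongs to $H_{\alpha,\mathfrak u}$ and is $C^\infty$ on $\Omega^{\mathfrak u}$. For every nonempty finite $\mathfrak u\subset\mathbb N$, $$\|G(u_{\mathfrak u})\|_{H_{\alpha,\mathfrak u}}\le\frac{C_{\kappa,\alpha}^{1/2}\,\|f\|_{V^*}\|G\|_{V^*}}{(1-\kappa)\,a_{0,\min}}\prod_{j\in\mathfrak u}b_j,\qquad C_{\kappa,\alpha}=\sum_{k\ge1}\Big(\frac{2\alpha\kappa}{1-\kappa}\Big)^{2k},$$ and the same upper bound holds for $$\Big(\sum_{\mathfrak v\subseteq\mathfrak u}\ \sum_{\tau\in\{1,\dots,\alpha-1\}^{\mathfrak u\setminus\mathfrak v}}\int_{\Omega^{\mathfrak v}}\big|\big(\partial_y^{(\alpha_{\mathfrak v},\tau)}G(u_{\mathfrak u})\big)(y_{\mathfrak v},0_{\mathfrak u\setminus\mathfrak v})\big|^2\,dy_{\mathfrak v}\Big)^{1/2},$$ where $\partial_y^{(\alpha_{\mathfrak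 v},\tau)}$ takes $\alpha$ derivatives in each $y_j$, $j\in\mathfrak v$, and $\tau_j$ derivatives in each $y_j$, $j\in\mathfrak u\setminus\mathfrak v$. In particular, with the product weights $\gamma_{\mathfrak u}=\prod_{j\in\mathfrak u}\gamma_j$, $\gamma_j=b_j$, $$\sup_{|\mathfrak u|<\infty}\gamma_{\mathfrak u}^{-1}\|G(u_{\mathfrak u})\|_{H_{\alpha,\mathfrak u}}<\infty.$$ -/

import Mathlib

open MeasureTheory Set
open scoped ContDiff Distributions

noncomputable section

namespace ParamPDE

/-! ### The physical function space `V = H₀¹(D)` -/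

/-- `L²(D; F)` for an open set `D ⊆ ℝᵈ`. -/
abbrev L2 {d : ℕ} (D : TopologicalSpace.Opens (EuclideanSpace ℝ (Fin d)))
    (F : Type) [NormedAddCommGroup F] : Type :=
  Lp F 2 (volume.restrict (D : Set (EuclideanSpace ℝ (Fin d))))

/-- The pairs `(v, ∇v) ∈ L²(D) × L²(D; ℝᵈ)` with `v ∈ H₀¹(D)`: the closure, in the `H¹(D)` topology,
of the pairs `(ψ, ∇ψ)` with `ψ ∈ C_c^∞(D)`. (Limits of such pairs satisfy the integration by parts
formula, so the second component is the weak gradient of the first one.) -/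
def h10Submodule {d : ℕ} (D : TopologicalSpace.Opens (EuclideanSpace ℝ (Fin d))) :
    Submodule ℝ (L2 D ℝ × L2 D (EuclideanSpace ℝ (Fin d))) :=
  (Submodule.span ℝ {p | ∃ ψ : 𝓓(D, ℝ),
    p.1 =ᵐ[volume.restrict (D : Set (EuclideanSpace ℝ (Fin d)))] (fun x => ψ x) ∧
    p.2 =ᵐ[volume.restrict (D : Set (EuclideanSpace ℝ (Fin d)))]
      (fun x => gradient ψ x)}).topologicalClosure

/-- The space `V = H₀¹(D)`; its norm is `‖v‖_V = ‖∇v‖_{L²(D)}`, see below. -/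
def H10 {d : ℕ} (D : TopologicalSpace.Opens (EuclideanSpace ℝ (Fin d))) : Type :=
  h10Submodule D

instance {d : ℕ} (D : TopologicalSpace.Opens (EuclideanSpace ℝ (Fin d))) : AddCommGroup (H10 D) :=
  inferInstanceAs (AddCommGroup (h10Submodule D))

instance {d : ℕ} (D : TopologicalSpace.Opens (EuclideanSpace ℝ (Fin d))) : Module ℝ (H10 D) :=
  inferInstanceAs (Module ℝ (h10Submodule D))

/-- The weak gradient `∇ : H₀¹(D) → L²(D; ℝᵈ)`. -/
def grad {d : ℕ} (D : TopologicalSpace.Opens (EuclideanSpace ℝ (Fin d))) :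
    H10 D →ₗ[ℝ] L2 D (EuclideanSpace ℝ (Fin d)) :=
  (LinearMap.snd ℝ (L2 D ℝ) (L2 D (EuclideanSpace ℝ (Fin d)))).comp (h10Submodule D).subtype

/-- `‖v‖_V = ‖∇v‖_{L²(D)}`. For bounded `D` this is a norm, by Poincaré's inequality. -/
instance {d : ℕ} (D : TopologicalSpace.Opens (EuclideanSpace ℝ (Fin d))) :
    SeminormedAddCommGroup (H10 D) :=
  SeminormedAddCommGroup.induced _ _ (grad D)

instance {d : ℕ} (D : TopologicalSpace.Opens (EuclideanSpace ℝ (Fin d))) : NormedSpace ℝ (H10 D) :=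
  NormedSpace.induced _ _ _ (grad D)

/-! ### The parametric problem -/

/-- The diffusion coefficient `a(x, y) = a₀(x) + ∑_j y_j φ_j(x)`. -/
def coeff {d : ℕ} (a₀ : EuclideanSpace ℝ (Fin d) → ℝ) (φ : ℕ → EuclideanSpace ℝ (Fin d) → ℝ)
    (y : ℕ → ℝ) (x : EuclideanSpace ℝ (Fin d)) : ℝ :=
  a₀ x + ∑' j, y j * φ j x

/-- `w ∈ V` solves `∫_D a(x, y) ∇w(x) · ∇v(x) dx = f(v)` for all `v ∈ V`. -/
def IsWeakSolution {d : ℕ} (D : TopologicalSpace.Opens (EuclideanSpace ℝ (Fin d)))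
    (a₀ : EuclideanSpace ℝ (Fin d) → ℝ) (φ : ℕ → EuclideanSpace ℝ (Fin d) → ℝ)
    (f : StrongDual ℝ (H10 D)) (y : ℕ → ℝ) (w : H10 D) : Prop :=
  ∀ v : H10 D, ∫ x in (D : Set (EuclideanSpace ℝ (Fin d))),
    coeff a₀ φ y x * inner ℝ (grad D w x) (grad D v x) = f v

/-- The parameter domain `Ω^ℕ` with `Ω = [-1/2, 1/2]`. -/
def paramDomain : Set (ℕ → ℝ) := {y | ∀ j, y j ∈ Icc (-(1 / 2) : ℝ) (1 / 2)}

/-- The anchored-decomposition term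
`u_𝔲(·, y_𝔲) = ∑_{𝔳 ⊆ 𝔲} (-1)^{|𝔲| - |𝔳|} u(·, y_𝔳)` (anchor `0`), where `(y_𝔳)_j = y_j` for `j ∈ 𝔳`
and `(y_𝔳)_j = 0` otherwise. -/
def anchoredTerm {V : Type} [AddCommGroup V] [Module ℝ V] (u : (ℕ → ℝ) → V) (s : Finset ℕ)
    (y : ℕ → ℝ) : V :=
  ∑ v ∈ s.powerset, (-1 : ℝ) ^ (s.card - v.card) • u ((v : Set ℕ).indicator y)

/-- A point of `ℝ^𝔲`, extended by `0`. -/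
def zeroExt (s : Finset ℕ) (z : s → ℝ) : ℕ → ℝ := fun j => if h : j ∈ s then z ⟨j, h⟩ else 0

/-- The constant `C_{κ,α} = ∑_{k ≥ 1} (2ακ / (1 - κ))^{2k}`. -/
def normConst (κ : ℝ) (α : ℕ) : ℝ := ∑' k : ℕ, (2 * α * κ / (1 - κ)) ^ (2 * (k + 1))

/-! ### The anchored Sobolev reproducing kernel Hilbert space -/

/-- `(s)_+^n`, with `(s)_+^0 = 1_{s > 0}`. -/
def truncPow (n : ℕ) (s : ℝ) : ℝ := if 0 < s then s ^ n else 0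

/-- The reproducing kernel on `[-1/2, 1/2]` of the space of functions `F` with `F(0) = 0` and inner
product `∑_{r=1}^{α-1} F^{(r)}(0) G^{(r)}(0) + ∫ F^{(α)} G^{(α)}`. The first integral vanishes unless
`x, y > 0`, the second one unless `x, y < 0`. -/
def kernel1 (α : ℕ) (x y : ℝ) : ℝ :=
  ∑ r ∈ Finset.Ico 1 α, x ^ r * y ^ r / ((r.factorial : ℝ) * r.factorial)
    + (∫ t in (0 : ℝ)..(1 / 2), truncPow (α - 1) (x - t) * truncPow (α - 1) (y - t)
        / (((α - 1).factorial : ℝ) * (α - 1).factorial))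
    + ∫ t in (-(1 / 2) : ℝ)..0, truncPow (α - 1) (t - x) * truncPow (α - 1) (t - y)
        / (((α - 1).factorial : ℝ) * (α - 1).factorial)

/-- The cube `[-1/2, 1/2]^𝔲`, as a type. -/
abbrev Cube (s : Finset ℕ) : Type := s → Icc (-(1 / 2) : ℝ) (1 / 2)

/-- The product kernel `K_{α,𝔲}(x, y) = ∏_{j ∈ 𝔲} K_α(x_j, y_j)`, each value being read as a
multiplication operator on `ℝ`. -/
def anchoredKernel (α : ℕ) (s : Finset ℕ) : Matrix (Cube s) (Cube s) (ℝ →L[ℝ] ℝ) :=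
  fun x y => (∏ j, kernel1 α (x j) (y j)) • ContinuousLinearMap.id ℝ ℝ

theorem truncPow_intervalIntegrable (n : ℕ) (c x y a b : ℝ) :
    IntervalIntegrable (fun t => truncPow n (x - t) * truncPow n (y - t) / c) volume a b ∧
    IntervalIntegrable (fun t => truncPow n (t - x) * truncPow n (t - y) / c) volume a b := by
  have meas : ∀ g : ℝ → ℝ, Measurable g → Measurable fun t => truncPow n (g t) := fun g hg =>
    Measurable.ite (measurableSet_lt measurable_const hg) (hg.pow_const n) measurable_const
  have bd : ∀ z : ℝ, |truncPow n z| ≤ |z| ^ n := by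
    intro z
    unfold truncPow
    split_ifs
    · rw [abs_pow]
    · simp
  constructor
  · have hc : Continuous fun t : ℝ => |x - t| ^ n * |y - t| ^ n / |c| := by
      fun_prop
    refine (hc.intervalIntegrable a b).mono_fun ?_ ?_
    · exact (((meas _ (by fun_prop)).mul (meas _ (by fun_prop))).div_const c).aestronglyMeasurable
    · refine Filter.Eventually.of_forall fun t => ?_
      simp only [Real.norm_eq_abs, abs_div, abs_mul, abs_abs, abs_pow]
      gcongr
      · exact bd _
      · exact bd _
  · have hc : Continuous fun t : ℝ => |t - x| ^ n * |t - y| ^ n / |c| := by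
      fun_prop
    refine (hc.intervalIntegrable a b).mono_fun ?_ ?_
    · exact (((meas _ (by fun_prop)).mul (meas _ (by fun_prop))).div_const c).aestronglyMeasurable
    · refine Filter.Eventually.of_forall fun t => ?_
      simp only [Real.norm_eq_abs, abs_div, abs_mul, abs_abs, abs_pow]
      gcongr
      · exact bd _
      · exact bd _

theorem posSemidef_of_integral {X T : Type} [MeasurableSpace T] (μ : Measure T) (g : X → T → ℝ)
    (hg : ∀ x y, Integrable (fun t => g x t * g y t) μ) :
    (Matrix.of fun x y => ∫ t, g x t * g y t ∂μ : Matrix X X ℝ).PosSemidef := by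
  refine ⟨?_, fun c => ?_⟩
  · ext x y
    simp [Matrix.conjTranspose_apply, mul_comm]
  · have hi : ∀ i j, Integrable (fun t => c i * g i t * (c j * g j t)) μ := fun i j =>
      ((hg i j).const_mul (c i * c j)).congr (Filter.Eventually.of_forall fun t => by ring)
    have h : (c.sum fun i xi => c.sum fun j xj => star xi * (Matrix.of fun x y => ∫ t, g x t * g y t ∂μ : Matrix X X ℝ) i j * xj)
        = ∫ t, (∑ i ∈ c.support, c i * g i t) ^ 2 ∂μ := by
      simp only [Finsupp.sum, star_trivial, sq, Finset.sum_mul_sum, Matrix.of_apply]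
      rw [integral_finsetSum _ fun i _ => integrable_finsetSum _ fun j _ => hi i j]
      refine Finset.sum_congr rfl fun i _ => ?_
      rw [integral_finsetSum _ fun j _ => hi i j]
      refine Finset.sum_congr rfl fun j _ => ?_
      rw [← integral_const_mul, ← integral_mul_const]
      exact integral_congr_ae (Filter.Eventually.of_forall fun t => by ring)
    exact h ▸ integral_nonneg fun t => sq_nonneg _

/-- The one-dimensional kernel is positive semidefinite. -/
theorem posSemidef_kernel1 (α : ℕ) :
    (Matrix.of fun x y => kernel1 α x y : Matrix ℝ ℝ ℝ).PosSemidef := by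
  have h1 : (Matrix.of fun x y => ∑ r ∈ Finset.Ico 1 α,
      x ^ r * y ^ r / ((r.factorial : ℝ) * r.factorial) : Matrix ℝ ℝ ℝ).PosSemidef := by
    have : (∑ r ∈ Finset.Ico 1 α, Matrix.of fun x y => ∫ _ : Unit,
        x ^ r / (r.factorial : ℝ) * (y ^ r / (r.factorial : ℝ)) ∂Measure.dirac () :
          Matrix ℝ ℝ ℝ).PosSemidef :=
      Matrix.posSemidef_sum _ fun r _ => posSemidef_of_integral _
        (fun (x : ℝ) (_ : Unit) => x ^ r / (r.factorial : ℝ)) fun x y => by simp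
    convert! this using 1
    ext x y
    simp [Matrix.sum_apply, div_mul_div_comm]
  have h2 := posSemidef_of_integral (volume.restrict (Ioc (0 : ℝ) (1 / 2)))
    (fun x t : ℝ => truncPow (α - 1) (x - t) / (α - 1).factorial) fun x y => by
      have := (truncPow_intervalIntegrable (α - 1)
        (((α - 1).factorial : ℝ) * (α - 1).factorial) x y 0 (1 / 2)).1
      rw [intervalIntegrable_iff_integrableOn_Ioc_of_le (by norm_num)] at this
      refine Integrable.congr this (Filter.Eventually.of_forall fun t => ?_)
      ring
  have h3 := posSemidef_of_integral (volume.restrict (Ioc (-(1 / 2) : ℝ) 0))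
    (fun x t : ℝ => truncPow (α - 1) (t - x) / (α - 1).factorial) fun x y => by
      have := (truncPow_intervalIntegrable (α - 1)
        (((α - 1).factorial : ℝ) * (α - 1).factorial) x y (-(1 / 2)) 0).2
      rw [intervalIntegrable_iff_integrableOn_Ioc_of_le (by norm_num)] at this
      refine Integrable.congr this (Filter.Eventually.of_forall fun t => ?_)
      ring
  refine Eq.subst (motive := Matrix.PosSemidef) ?_ ((h1.add h2).add h3)
  symm
  ext x y
  simp only [kernel1, Matrix.add_apply, Matrix.of_apply]
  rw [intervalIntegral.integral_of_le (by norm_num), intervalIntegral.integral_of_le (by norm_num)]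
  simp only [div_mul_div_comm]

theorem posSemidef_prod_kernel1 (α : ℕ) (s : Finset ℕ) :
    (Matrix.of fun x y => ∏ j, kernel1 α (x j) (y j) : Matrix (Cube s) (Cube s) ℝ).PosSemidef := by
  suffices ∀ t : Finset s, (Matrix.of fun x y => ∏ j ∈ t, kernel1 α (x j) (y j) :
      Matrix (Cube s) (Cube s) ℝ).PosSemidef from this Finset.univ
  intro t
  induction t using Finset.induction_on with
  | empty =>
    have := posSemidef_of_integral (Measure.dirac ()) (fun (_ : Cube s) (_ : Unit) => (1 : ℝ))
      fun _ _ => by simp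
    simpa using this
  | insert a t ha ih =>
    refine Eq.subst (motive := Matrix.PosSemidef) ?_
      (((posSemidef_kernel1 α).submatrix (fun x : Cube s => (x a : ℝ))).hadamard ih)
    symm
    ext x y
    simp [Finset.prod_insert ha, Matrix.hadamard_apply]

instance anchoredKernel_posSemidef (α : ℕ) (s : Finset ℕ) :
    Fact (anchoredKernel α s).PosSemidef := by
  have hp := posSemidef_prod_kernel1 α s
  have tf := (RKHS.posSemidef_tfae (K := anchoredKernel α s)).out 0 2
  refine ⟨tf.mpr ⟨?_, fun c => ?_⟩⟩
  · refine Matrix.IsHermitian.ext fun x y => ?_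
    have h : ∏ j, kernel1 α (y j) (x j) = ∏ j, kernel1 α (x j) (y j) := by
      simpa using hp.isHermitian.apply x y
    rw [anchoredKernel, h, star_smul, star_trivial]
    exact congrArg _ (star_one (ℝ →L[ℝ] ℝ))
  · have h := hp.2 c
    simp only [Finsupp.sum, star_trivial, Matrix.of_apply] at h
    simp only [Finsupp.sum, anchoredKernel, smul_apply, RCLike.re_to_real]
    rw [Finset.sum_comm]
    refine h.trans_eq (Finset.sum_congr rfl fun x _ => Finset.sum_congr rfl fun y _ => ?_)
    simp
    ring

/-- The space `H_{α,𝔲}`: the reproducing kernel Hilbert space of real functions on `[-1/2, 1/2]^𝔲`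
with kernel `K_{α,𝔲}`. -/
abbrev AnchoredRKHS (α : ℕ) (s : Finset ℕ) : Type := RKHS.OfKernel (anchoredKernel α s)

/-! ### The Sobolev expression of the norm -/

/-- `∂F/∂z_j`. -/
def partialDeriv {ι : Type} [DecidableEq ι] (j : ι) (F : (ι → ℝ) → ℝ) (z : ι → ℝ) : ℝ :=
  deriv (fun t => F (Function.update z j t)) (z j)

/-- The mixed derivative `∂^ν F`, with `ν_j` derivatives in the `j`-th variable. (They are taken in
some fixed order of the variables, which is immaterial for smooth `F`.) -/
def mixedPartial {ι : Type} [Fintype ι] [DecidableEq ι] (ν : ι → ℕ) (F : (ι → ℝ) → ℝ) :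
    (ι → ℝ) → ℝ :=
  Finset.univ.toList.foldr (fun j H => (partialDeriv j)^[ν j] H) F

/-- The squared anchored Sobolev norm
`∑_{𝔳 ⊆ 𝔲} ∑_{τ ∈ {1,…,α-1}^{𝔲∖𝔳}} ∫_{[-1/2,1/2]^𝔳} |(∂^{(α_𝔳, τ)} F)(y_𝔳, 0)|² dy_𝔳`.
The pair `(α_𝔳, τ)` is the multi-index `ν`. -/
def sobolevSq {ι : Type} [Fintype ι] [DecidableEq ι] (α : ℕ) (F : (ι → ℝ) → ℝ) : ℝ :=
  ∑ v : Finset ι, ∑ ν ∈ Fintype.piFinset fun j => if j ∈ v then {α} else Finset.Icc 1 (α - 1),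
    ∫ t : v → ℝ in Set.univ.pi fun _ => Icc (-(1 / 2) : ℝ) (1 / 2),
      (mixedPartial ν F fun j => if h : j ∈ v then t ⟨j, h⟩ else 0) ^ 2

end ParamPDE

end

open ParamPDE

noncomputable section

namespace ParamPDE

/-! Both norms involve only mixed derivatives whose order in every variable of `𝔲` lies between `1`
and `α`. For such orders anchoring is invisible: each term with `𝔳 ≠ 𝔲` is constant in some
differentiated variable, so the derivatives of `G(u_𝔲)` are those of `G(u)`
(`anchoredFamily_of_forall_ne_zero`). What remains is to bound the derivatives of `u` and to pass
from derivatives to the norm of the reproducing kernel space.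

Derivatives of `u`: by Poincaré's inequality the gradients of `H₀¹(D)` form a Hilbert space, on
which the problem reads `(A₀ + ∑ z_j A_j) u = f`. Put `p_ν = ∂^ν u / (ν! b^ν)`. Differentiating the
equation, pairing with `p_ν` and applying Young's inequality shows that the total energy of all
`p_ν` with `|ν| = k + 1` is at most `(2κ/(1-κ))²` times that for `|ν| = k`
(`EnergyBound.sum_inner_succ_le`). Treating a whole order at once yields `ν!` instead of `|ν|!`
(`EnergyBound.norm_solDeriv_le`), so the bound is a product over the variables; this is why product
weights suffice.

From derivatives to the norm: `K_α` is the Gram kernel of the Taylor features (monomials and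
truncated powers) in an `L²` space over pairs (order, point), and the product kernel is that of the
product measure. Taylor's formula at the anchor writes a function vanishing whenever a coordinate is
`0` as `⟪Φ z, h⟫`, where `h` lists its mixed derivatives (`integral_prod_feat_mul`). Hence the
function lies in the space with norm at most `‖h‖` (`exists_rkhs_of_feature`).

Integrating the product bound gives a power of `∑_{r=1}^{α} (r! (2κ/(1-κ))^r)²`. With `ρ =
2ακ/(1-κ)` this sum is at most `ρ²`, and `κ < 1/(2α+1)` means `ρ < 1`; so every positive power is at
most `ρ²`, the first term of `C_{κ,α}`. -/

/-! ### Feature maps and reproducing kernel Hilbert spaces -/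

/-- If the kernel of a scalar reproducing kernel Hilbert space factors through a feature map `Φ`
into a Hilbert space, then each `x ↦ ⟪Φ x, h⟫` belongs to the space, with norm at most `‖h‖`. -/
theorem exists_rkhs_of_feature {X H L : Type*} [NormedAddCommGroup H] [InnerProductSpace ℝ H]
    [CompleteSpace H] [RKHS ℝ H X ℝ] [NormedAddCommGroup L] [InnerProductSpace ℝ L]
    [CompleteSpace L] (Φ : X → L)
    (hΦ : ∀ x y, RKHS.kernel H x y 1 = inner ℝ (Φ x) (Φ y)) (h : L) :
    ∃ F : H, (∀ x, F x = inner ℝ (Φ x) h) ∧ ‖F‖ ≤ ‖h‖ := by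
  let k : X → H := fun x => RKHS.kerFun H x 1
  let lc : (X →₀ ℝ) →ₗ[ℝ] H := Finsupp.linearCombination ℝ k
  let lΦ : (X →₀ ℝ) →ₗ[ℝ] L := Finsupp.linearCombination ℝ Φ
  have hkk : ∀ x y, inner ℝ (k x) (k y) = inner ℝ (Φ x) (Φ y) := fun x y => by
    rw [← hΦ x y]
    simp only [k, RKHS.kerFun_inner, RKHS.kerFun_apply]
    simp
  have hnorm : ∀ c, ‖lc c‖ = ‖lΦ c‖ := fun c => by
    rw [← sq_eq_sq₀ (norm_nonneg _) (norm_nonneg _), ← real_inner_self_eq_norm_sq,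
      ← real_inner_self_eq_norm_sq]
    simp only [lc, lΦ, Finsupp.linearCombination_apply, Finsupp.sum, sum_inner, inner_sum,
      real_inner_smul_left, real_inner_smul_right, hkk]
  have heval : ∀ c x, lc c x = inner ℝ (Φ x) (lΦ c) := fun c x => by
    have h1 : inner ℝ (k x) (lc c) = lc c x := by simp [k]
    rw [← h1]
    simp only [lc, lΦ, Finsupp.linearCombination_apply, Finsupp.sum, inner_sum,
      real_inner_smul_right, hkk]
  -- Pairing with features only sees the projection of `h` onto their closed span. There `h` is a
  -- limit of finite combinations, which the isometry `lΦ c ↦ lc c` carries to a Cauchy sequence in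
  -- `H`.
  let N : Submodule ℝ L := (LinearMap.range lΦ).topologicalClosure
  have : CompleteSpace N :=
    (Submodule.isClosed_topologicalClosure _).completeSpace_coe
  have hPmem : N.starProjection h ∈ closure (Set.range lΦ) := by
    have := N.starProjection_apply_mem h
    rwa [← SetLike.mem_coe, Submodule.topologicalClosure_coe, LinearMap.coe_range] at this
  obtain ⟨s, hs, hlim⟩ := mem_closure_iff_seq_limit.1 hPmem
  choose c hc using hs
  have hcau : CauchySeq fun n => lc (c n) := by
    have h1 : CauchySeq fun n => lΦ (c n) := by simpa [hc] using hlim.cauchySeq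
    rw [Metric.cauchySeq_iff] at h1 ⊢
    intro ε hε
    obtain ⟨n0, hn0⟩ := h1 ε hε
    refine ⟨n0, fun m hm n hn => ?_⟩
    have := hn0 m hm n hn
    rwa [dist_eq_norm, ← map_sub, ← hnorm, map_sub, ← dist_eq_norm] at this
  obtain ⟨F, hF⟩ := cauchySeq_tendsto_of_complete hcau
  refine ⟨F, fun x => ?_, ?_⟩
  · have h1 : Filter.Tendsto (fun n => lc (c n) x) Filter.atTop (nhds (F x)) :=
      ((RKHS.continuous_eval x).tendsto F).comp hF
    have h2 : Filter.Tendsto (fun n => lc (c n) x) Filter.atTop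
        (nhds (inner ℝ (Φ x) (N.starProjection h))) := by
      simp only [heval, hc]
      exact tendsto_const_nhds.inner hlim
    rw [tendsto_nhds_unique h1 h2]
    have hx : Φ x ∈ N := (LinearMap.range lΦ).le_topologicalClosure
      ⟨Finsupp.single x 1, by simp [lΦ]⟩
    rw [Submodule.inner_starProjection_left_eq_right _ _ _ |>.symm,
      Submodule.starProjection_eq_self_iff.2 hx]
  · have h1 : Filter.Tendsto (fun n => ‖lc (c n)‖) Filter.atTop (nhds ‖F‖) := hF.norm
    have h2 : Filter.Tendsto (fun n => ‖lc (c n)‖) Filter.atTop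
        (nhds ‖N.starProjection h‖) := by
      simp only [hnorm, hc]
      exact hlim.norm
    rw [tendsto_nhds_unique h1 h2]
    exact N.norm_starProjection_apply_le h

/-! ### A feature map for the one-dimensional kernel -/

/-- The measure `∑_{r=1}^{α-1} δ_{(r,0)} + δ_α ⊗ λ` on `ℕ × ℝ`, where `λ` is Lebesgue measure on
`[-1/2, 1/2]`. The first component is the order of a derivative, the second one the point where it
is taken. -/
def featMeasure (α : ℕ) : Measure (ℕ × ℝ) :=
  ∑ r ∈ Finset.Ico 1 α, Measure.dirac (r, (0 : ℝ))
    + (volume.restrict (Icc (-(1 / 2) : ℝ) (1 / 2))).map (Prod.mk α)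

/-- The one-dimensional features: monomials and signed truncated powers. -/
def feat (α : ℕ) (x : ℝ) (e : ℕ × ℝ) : ℝ :=
  if e.1 = α then
    (if 0 < e.2 then truncPow (α - 1) (x - e.2) else
      (-1) ^ α * truncPow (α - 1) (e.2 - x)) / (α - 1).factorial
  else x ^ e.1 / e.1.factorial

theorem measurable_truncPow (n : ℕ) : Measurable (truncPow n) :=
  Measurable.ite measurableSet_Ioi (measurable_id.pow_const n) measurable_const

theorem abs_truncPow_le (n : ℕ) (z : ℝ) : |truncPow n z| ≤ |z| ^ n := by
  unfold truncPow
  split_ifs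
  · rw [abs_pow]
  · simp

theorem measurable_feat (α : ℕ) (x : ℝ) : Measurable (feat α x) := by
  refine measurable_from_prod_countable_right fun r => ?_
  unfold feat
  dsimp only
  split_ifs
  · refine Measurable.div_const (Measurable.ite measurableSet_Ioi ?_ ?_) _
    · exact (measurable_truncPow _).comp (by fun_prop)
    · exact ((measurable_truncPow _).comp (by fun_prop)).const_mul _
  · exact measurable_const

instance (α : ℕ) : IsFiniteMeasure (featMeasure α) := by
  unfold featMeasure
  infer_instance

theorem integral_featMeasure (α : ℕ) (g : ℕ × ℝ → ℝ) (hg : Measurable g) (C : ℝ)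
    (hC : ∀ᵐ e ∂featMeasure α, |g e| ≤ C) :
    Integrable g (featMeasure α) ∧
    ∫ e, g e ∂featMeasure α =
      ∑ r ∈ Finset.Ico 1 α, g (r, 0) + ∫ t in (-(1 / 2) : ℝ)..(1 / 2), g (α, t) := by
  have hi : Integrable g (featMeasure α) :=
    Integrable.of_bound hg.aestronglyMeasurable C (by simpa using hC)
  refine ⟨hi, ?_⟩
  have hi' := hi
  rw [featMeasure, integrable_add_measure] at hi'
  rw [featMeasure, integral_add_measure hi'.1 hi'.2, intervalIntegral.integral_of_le (by norm_num),
    ← integral_Icc_eq_integral_Ioc]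
  congr 1
  · rw [integral_finsetSum_measure]
    · refine Finset.sum_congr rfl fun r _ => ?_
      rw [integral_dirac]
    · exact fun r hr => (integrable_finsetSum_measure.1 hi'.1) r hr
  · exact integral_map (by fun_prop) hg.aestronglyMeasurable

theorem ae_featMeasure {α : ℕ} (hα : 1 ≤ α) :
    ∀ᵐ e ∂featMeasure α, (e.1 = α ∨ e.2 = 0) ∧ e.1 ∈ Finset.Icc 1 α ∧
      e.2 ∈ Icc (-(1 / 2) : ℝ) (1 / 2) := by
  have hm : MeasurableSet {e : ℕ × ℝ | (e.1 = α ∨ e.2 = 0) ∧ e.1 ∈ Finset.Icc 1 α ∧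
      e.2 ∈ Icc (-(1 / 2) : ℝ) (1 / 2)} := by
    refine ((measurableSet_eq_fun measurable_fst measurable_const).union
      (measurableSet_eq_fun measurable_snd measurable_const)).inter
      (MeasurableSet.inter ?_ ?_)
    · exact measurable_fst (Finset.measurableSet (Finset.Icc 1 α))
    · exact measurable_snd measurableSet_Icc
  rw [featMeasure, ae_add_measure_iff]
  constructor
  · rw [ae_finsetSum_measure_iff]
    intro r hr
    rw [Finset.mem_Ico] at hr
    rw [ae_dirac_iff hm]
    simp
    omega
  · rw [ae_map_iff (by fun_prop) hm]
    filter_upwards [ae_restrict_mem measurableSet_Icc] with t ht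
    simpa [hα] using ht

theorem abs_feat_le_one {α : ℕ} {x : ℝ} (hx : x ∈ Icc (-(1 / 2) : ℝ) (1 / 2)) {e : ℕ × ℝ}
    (he : e.2 ∈ Icc (-(1 / 2) : ℝ) (1 / 2)) : |feat α x e| ≤ 1 := by
  have hfac : ∀ n : ℕ, (1 : ℝ) ≤ (n.factorial : ℝ) := fun n => by
    exact_mod_cast Nat.one_le_iff_ne_zero.2 n.factorial_ne_zero
  have hxt : |x - e.2| ≤ 1 := by rw [abs_le]; constructor <;> linarith [hx.1, hx.2, he.1, he.2]
  have htx : |e.2 - x| ≤ 1 := by rwa [abs_sub_comm]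
  have hx1 : |x| ≤ 1 := by rw [abs_le]; constructor <;> linarith [hx.1, hx.2]
  unfold feat
  split_ifs
  all_goals
    rw [abs_div, Nat.abs_cast, div_le_one (lt_of_lt_of_le one_pos (hfac _))]
    refine le_trans ?_ (hfac _)
  · exact (abs_truncPow_le _ _).trans (pow_le_one₀ (abs_nonneg _) hxt)
  · rw [abs_mul, abs_pow, abs_neg, abs_one, one_pow, one_mul]
    exact (abs_truncPow_le _ _).trans (pow_le_one₀ (abs_nonneg _) htx)
  · rw [abs_pow]
    exact pow_le_one₀ (abs_nonneg _) hx1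

/-- The three terms of the kernel are the contributions of the atoms, of `t > 0` and of `t ≤ 0`. The
sign `(-1) ^ α` in the features squares to one, so the kernel does not see it; Taylor's formula to
the left of `0` does. -/
theorem kernel1_eq_integral {α : ℕ} (hα : 1 ≤ α) {x y : ℝ}
    (hx : x ∈ Icc (-(1 / 2) : ℝ) (1 / 2)) (hy : y ∈ Icc (-(1 / 2) : ℝ) (1 / 2)) :
    kernel1 α x y = ∫ e, feat α x e * feat α y e ∂featMeasure α := by
  obtain ⟨hi, h⟩ := integral_featMeasure α (fun e => feat α x e * feat α y e)
    ((measurable_feat α x).mul (measurable_feat α y)) 1 (by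
      filter_upwards [ae_featMeasure hα] with e he
      rw [abs_mul]
      exact mul_le_one₀ (abs_feat_le_one hx he.2.2) (abs_nonneg _) (abs_feat_le_one hy he.2.2))
  rw [h, kernel1, add_assoc]
  have hint : IntervalIntegrable (fun t => feat α x (α, t) * feat α y (α, t)) volume
      (-(1 / 2)) (1 / 2) := by
    have hm : Measurable fun t => feat α x (α, t) * feat α y (α, t) :=
      ((measurable_feat α x).mul (measurable_feat α y)).comp measurable_prodMk_left
    rw [intervalIntegrable_iff_integrableOn_Icc_of_le (by norm_num)]
    refine Integrable.of_bound hm.aestronglyMeasurable 1 ?_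
    filter_upwards [ae_restrict_mem measurableSet_Icc] with t ht
    rw [Real.norm_eq_abs, abs_mul]
    exact mul_le_one₀ (abs_feat_le_one hx ht) (abs_nonneg _) (abs_feat_le_one hy ht)
  have hsub1 : IntervalIntegrable (fun t => feat α x (α, t) * feat α y (α, t)) volume
      (-(1 / 2)) 0 := hint.mono_set (by
        rw [uIcc_of_le (by norm_num), uIcc_of_le (by norm_num)]
        exact Icc_subset_Icc le_rfl (by norm_num))
  have hsub2 : IntervalIntegrable (fun t => feat α x (α, t) * feat α y (α, t)) volume
      0 (1 / 2) := hint.mono_set (by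
        rw [uIcc_of_le (by norm_num), uIcc_of_le (by norm_num)]
        exact Icc_subset_Icc (by norm_num) le_rfl)
  rw [← intervalIntegral.integral_add_adjacent_intervals hsub1 hsub2, add_comm (∫ t in _..0, _)]
  congr 1
  · refine Finset.sum_congr rfl fun r hr => ?_
    have : r ≠ α := by rw [Finset.mem_Ico] at hr; omega
    simp [feat, this, div_mul_div_comm]
  · congr 1
    · rw [intervalIntegral.integral_of_le (by norm_num), intervalIntegral.integral_of_le (by norm_num)]
      refine setIntegral_congr_fun measurableSet_Ioc fun t ht => ?_
      simp [feat, ht.1, div_mul_div_comm]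
    · rw [intervalIntegral.integral_of_le (by norm_num), intervalIntegral.integral_of_le (by norm_num)]
      refine setIntegral_congr_fun measurableSet_Ioc fun t ht => ?_
      have h1 : ((-1 : ℝ) ^ α) * (-1) ^ α = 1 := by rw [← mul_pow]; simp
      simp only [feat, if_true, if_neg (not_lt.2 ht.2), div_mul_div_comm]
      congr 1
      linear_combination (-(truncPow (α - 1) (t - x) * truncPow (α - 1) (t - y))) * h1

/-! ### Taylor's formula at the anchor in one variable -/

/-- The derivative of a Taylor polynomial with respect to its centre. -/
theorem hasDerivAt_sum_taylor {d : ℕ → ℝ → ℝ} {t : ℝ} (x : ℝ)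
    (hd : ∀ r, HasDerivAt (d r) (d (r + 1) t) t) (n : ℕ) :
    HasDerivAt (fun t => ∑ r ∈ Finset.range (n + 1), d r t * ((x - t) ^ r / r.factorial))
      (d (n + 1) t * ((x - t) ^ n / n.factorial)) t := by
  induction n with
  | zero => simpa using hd 0
  | succ n ih =>
    simp only [Finset.sum_range_succ _ (n + 1)]
    have h1 : HasDerivAt (fun t : ℝ => (x - t) ^ (n + 1) / ((n + 1).factorial : ℝ))
        (-((x - t) ^ n / n.factorial)) t := by
      have := (((hasDerivAt_id t).const_sub x).pow (n + 1)).div_const ((n + 1).factorial : ℝ)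
      refine this.congr_deriv ?_
      have h2 : (n.factorial : ℝ) ≠ 0 := by exact_mod_cast n.factorial_ne_zero
      rw [Nat.factorial_succ]
      push_cast
      simp only [id]
      field_simp
    refine (ih.add ((hd (n + 1)).mul h1)).congr_deriv ?_
    ring

/-- Differentiating a Taylor polynomial in its centre telescopes to the remainder integrand, so this
is the fundamental theorem of calculus. An endpoint equal to `x` contributes just `d 0 x`. -/
theorem integral_taylor_remainder {d : ℕ → ℝ → ℝ} (hc : ∀ r, Continuous (d r)) {a b : ℝ}
    (hab : a ≤ b) (hd : ∀ r, ∀ t ∈ Ioo a b, HasDerivAt (d r) (d (r + 1) t) t) (x : ℝ) (n : ℕ) :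
    ∫ t in a..b, d (n + 1) t * ((x - t) ^ n / n.factorial) =
      ∑ r ∈ Finset.range (n + 1), d r b * ((x - b) ^ r / r.factorial) -
      ∑ r ∈ Finset.range (n + 1), d r a * ((x - a) ^ r / r.factorial) := by
  refine intervalIntegral.integral_eq_sub_of_hasDerivAt_of_le hab ?_
    (fun t ht => hasDerivAt_sum_taylor x (fun r => hd r t ht) n) ?_
  · exact Continuous.continuousOn (by fun_prop)
  · exact Continuous.intervalIntegrable (by fun_prop) _ _

theorem sum_range_taylor_self (d : ℕ → ℝ → ℝ) (x : ℝ) (n : ℕ) :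
    ∑ r ∈ Finset.range (n + 1), d r x * ((x - x) ^ r / r.factorial) = d 0 x := by
  rw [Finset.sum_range_succ']
  simp

/-- As a function of `t`, the feature of order `α` is the Peano kernel of expansion at `0`: up to
endpoints it lives between `0` and `x`, whichever side `x` is on. -/
theorem setIntegral_feat {α : ℕ} (hα : 1 ≤ α) {d : ℕ → ℝ → ℝ} (hc : ∀ r, Continuous (d r))
    (hd : ∀ r, ∀ t ∈ Ioo (-(1 / 2) : ℝ) (1 / 2), HasDerivAt (d r) (d (r + 1) t) t)
    {x : ℝ} (hx : x ∈ Icc (-(1 / 2) : ℝ) (1 / 2)) :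
    ∫ t in (-(1 / 2) : ℝ)..(1 / 2), feat α x (α, t) * d α t =
      d 0 x - ∑ r ∈ Finset.range α, x ^ r / r.factorial * d r 0 := by
  obtain ⟨n, rfl⟩ : ∃ n, α = n + 1 := ⟨α - 1, by omega⟩
  rw [intervalIntegral.integral_of_le (by norm_num)]
  rcases le_or_gt 0 x with h0 | h0
  · have h1 : ∫ t in Ioc (-(1 / 2) : ℝ) (1 / 2), feat (n + 1) x (n + 1, t) * d (n + 1) t =
        ∫ t in Ioc (-(1 / 2) : ℝ) (1 / 2), (Ioo 0 x).indicator
          (fun t => d (n + 1) t * ((x - t) ^ n / n.factorial)) t := by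
      refine setIntegral_congr_fun measurableSet_Ioc fun t ht => ?_
      by_cases hp : 0 < t
      · by_cases htx : t < x
        · rw [indicator_of_mem (show t ∈ Ioo 0 x from ⟨hp, htx⟩)]
          simp [feat, hp, truncPow, htx]
          ring
        · rw [indicator_of_notMem (fun h => htx h.2)]
          simp [feat, hp, truncPow, htx]
      · rw [indicator_of_notMem (fun h => hp h.1)]
        simp [feat, hp, truncPow, not_lt.2 (show t ≤ x by linarith)]
    rw [h1, setIntegral_indicator measurableSet_Ioo, inter_eq_self_of_subset_right,
      ← integral_Ioc_eq_integral_Ioo, ← intervalIntegral.integral_of_le h0,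
      integral_taylor_remainder hc h0 (fun r t ht => hd r t
        ⟨by linarith [ht.1], by linarith [ht.2, hx.2]⟩), sum_range_taylor_self]
    · simp [mul_comm]
    · exact fun t ht => ⟨by linarith [ht.1], by linarith [ht.2, hx.2]⟩
  · have h1 : ∫ t in Ioc (-(1 / 2) : ℝ) (1 / 2), feat (n + 1) x (n + 1, t) * d (n + 1) t =
        ∫ t in Ioc (-(1 / 2) : ℝ) (1 / 2), (Ioc x 0).indicator
          (fun t => -(d (n + 1) t * ((x - t) ^ n / n.factorial))) t := by
      refine setIntegral_congr_fun measurableSet_Ioc fun t ht => ?_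
      by_cases hp : 0 < t
      · rw [indicator_of_notMem (fun h => absurd h.2 (not_le.2 hp))]
        simp [feat, hp, truncPow, not_lt.2 (show x ≤ t by linarith)]
      · by_cases htx : x < t
        · rw [indicator_of_mem (show t ∈ Ioc x 0 from ⟨htx, not_lt.1 hp⟩)]
          -- The sign built into the feature produces minus the Taylor kernel; the minus accounts
          -- for integrating from `0` down to `x < 0`.
          have h2 : (-1 : ℝ) ^ (n + 1) * (t - x) ^ n = -(x - t) ^ n := by
            rw [← neg_sub t x, neg_pow (t - x) n, pow_succ]
            ring
          simp [feat, hp, truncPow, htx, h2]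
          ring
        · rw [indicator_of_notMem (fun h => htx h.1)]
          simp [feat, hp, truncPow, htx]
    rw [h1, setIntegral_indicator measurableSet_Ioc, inter_eq_self_of_subset_right,
      ← intervalIntegral.integral_of_le h0.le, intervalIntegral.integral_neg,
      integral_taylor_remainder hc h0.le (fun r t ht => hd r t
        ⟨by linarith [ht.1, hx.1], by linarith [ht.2]⟩), sum_range_taylor_self]
    · simp [mul_comm]
    · exact fun t ht => ⟨by linarith [ht.1, hx.1], by linarith [ht.2]⟩

/-- Taylor's formula at `0`, for a function vanishing at `0`, in terms of the features. -/
theorem integral_feat_mul {α : ℕ} (hα : 1 ≤ α) {d : ℕ → ℝ → ℝ} (hc : ∀ r, Continuous (d r))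
    (hd : ∀ r, ∀ t ∈ Ioo (-(1 / 2) : ℝ) (1 / 2), HasDerivAt (d r) (d (r + 1) t) t)
    (h0 : d 0 0 = 0) {x : ℝ} (hx : x ∈ Icc (-(1 / 2) : ℝ) (1 / 2)) :
    ∫ e, feat α x e * d e.1 e.2 ∂featMeasure α = d 0 x := by
  have hm : Measurable fun e : ℕ × ℝ => feat α x e * d e.1 e.2 :=
    (measurable_feat α x).mul (measurable_from_prod_countable_right fun r => (hc r).measurable)
  have hbd : ∃ C, ∀ᵐ e ∂featMeasure α, |feat α x e * d e.1 e.2| ≤ C := by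
    have : ∀ r, ∃ C, ∀ t ∈ Icc (-(1 / 2) : ℝ) (1 / 2), ‖d r t‖ ≤ C := fun r =>
      isCompact_Icc.exists_bound_of_continuousOn (hc r).continuousOn
    choose C hC using this
    refine ⟨∑ r ∈ Finset.Icc 1 α, |C r|, ?_⟩
    filter_upwards [ae_featMeasure hα] with e he
    rw [abs_mul]
    refine (mul_le_of_le_one_left (abs_nonneg _) (abs_feat_le_one hx he.2.2)).trans ?_
    refine ((hC e.1 e.2 he.2.2).trans (le_abs_self _)).trans ?_
    exact Finset.single_le_sum (f := fun r => |C r|) (fun _ _ => abs_nonneg _) he.2.1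
  obtain ⟨C, hC⟩ := hbd
  -- The atoms supply the Taylor terms of orders `1, …, α - 1`, cancelling those subtracted by the
  -- remainder; the term of order `0` vanishes by `h0`.
  rw [(integral_featMeasure α _ hm C hC).2, setIntegral_feat hα hc hd hx,
    ← Finset.sum_range_add_sum_Ico _ hα]
  have : ∀ r ∈ Finset.Ico 1 α, feat α x (r, 0) * d r 0 = x ^ r / r.factorial * d r 0 := by
    intro r hr
    have : r ≠ α := by rw [Finset.mem_Ico] at hr; omega
    simp [feat, this]
  rw [Finset.sum_congr rfl this]
  simp [h0]

/-! ### Taylor's formula in several variables -/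

theorem ae_pi_featMeasure {ι : Type*} [Fintype ι] {α : ℕ} (hα : 1 ≤ α) :
    ∀ᵐ e ∂Measure.pi fun _ : ι => featMeasure α, ∀ j, ((e j).1 = α ∨ (e j).2 = 0) ∧
      (e j).1 ∈ Finset.Icc 1 α ∧ (e j).2 ∈ Icc (-(1 / 2) : ℝ) (1 / 2) := by
  rw [ae_all_iff]
  intro j
  exact (Measure.tendsto_eval_ae_ae (μ := fun _ : ι => featMeasure α) (i := j)).eventually
    (ae_featMeasure hα)

theorem measurable_pi_feat {ι : Type*} [Fintype ι] {α : ℕ} (z : ι → ℝ) :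
    Measurable fun e : ι → ℕ × ℝ => ∏ j, feat α (z j) (e j) :=
  Finset.measurable_prod _ fun j _ => (measurable_feat α (z j)).comp (measurable_pi_apply j)

theorem abs_prod_feat_le_one {ι : Type*} [Fintype ι] {α : ℕ} {z : ι → ℝ}
    (hz : ∀ j, z j ∈ Icc (-(1 / 2) : ℝ) (1 / 2)) {e : ι → ℕ × ℝ}
    (he : ∀ j, (e j).2 ∈ Icc (-(1 / 2) : ℝ) (1 / 2)) : |∏ j, feat α (z j) (e j)| ≤ 1 := by
  rw [Finset.abs_prod]
  exact Finset.prod_le_one (fun _ _ => abs_nonneg _) fun j _ => abs_feat_le_one (hz j) (he j)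

theorem continuous_family {ι : Type*} [Fintype ι] {D : (ι → ℕ) → (ι → ℝ) → ℝ}
    (hc : ∀ ν, Continuous (D ν)) :
    Continuous fun e : ι → ℕ × ℝ => D (fun j => (e j).1) fun j => (e j).2 := by
  have h : Continuous fun p : (ι → ℕ) × (ι → ℝ) => D p.1 p.2 :=
    continuous_prod_of_discrete_left.2 hc
  exact h.comp (f := fun e : ι → ℕ × ℝ => ((fun j => (e j).1), fun j => (e j).2)) (by fun_prop)

theorem exists_bound_family {ι : Type*} [Fintype ι] {D : (ι → ℕ) → (ι → ℝ) → ℝ}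
    (hc : ∀ ν, Continuous (D ν)) (α : ℕ) :
    ∃ C, ∀ ν : ι → ℕ, (∀ j, ν j ∈ Finset.Icc 1 α) → ∀ z : ι → ℝ,
      (∀ j, z j ∈ Icc (-(1 / 2) : ℝ) (1 / 2)) → |D ν z| ≤ C := by
  classical
  have : ∀ ν, ∃ C, ∀ z ∈ Set.univ.pi fun _ : ι => Icc (-(1 / 2) : ℝ) (1 / 2), ‖D ν z‖ ≤ C :=
    fun ν => (isCompact_univ_pi fun _ => isCompact_Icc).exists_bound_of_continuousOn
      (hc ν).continuousOn
  choose C hC using this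
  refine ⟨∑ ν ∈ Fintype.piFinset fun _ : ι => Finset.Icc 1 α, |C ν|, fun ν hν z hz => ?_⟩
  refine ((hC ν z fun j _ => hz j).trans (le_abs_self _)).trans ?_
  exact Finset.single_le_sum (f := fun r => |C r|) (fun _ _ => abs_nonneg _)
    (Fintype.mem_piFinset.2 hν)

theorem integrable_prod_feat_mul {ι : Type*} [Fintype ι] {α : ℕ} (hα : 1 ≤ α)
    {D : (ι → ℕ) → (ι → ℝ) → ℝ} (hc : ∀ ν, Continuous (D ν))
    {z : ι → ℝ} (hz : ∀ j, z j ∈ Icc (-(1 / 2) : ℝ) (1 / 2)) :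
    Integrable (fun e : ι → ℕ × ℝ =>
      (∏ j, feat α (z j) (e j)) * D (fun j => (e j).1) (fun j => (e j).2))
      (Measure.pi (fun _ : ι => featMeasure α)) := by
  obtain ⟨C, hC⟩ := exists_bound_family hc α
  refine Integrable.of_bound
    ((measurable_pi_feat z).mul (continuous_family hc).measurable).aestronglyMeasurable C ?_
  filter_upwards [ae_pi_featMeasure hα] with e he
  rw [Real.norm_eq_abs, abs_mul]
  exact (mul_le_of_le_one_left (abs_nonneg _) (abs_prod_feat_le_one hz fun j => (he j).2.2)).trans
    (hC _ (fun j => (he j).2.1) _ fun j => (he j).2.2)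

/-- The anchored Taylor formula in several variables, in terms of the features. -/
theorem integral_prod_feat_mul_fin {α : ℕ} (hα : 1 ≤ α) (n : ℕ)
    (D : (Fin n → ℕ) → (Fin n → ℝ) → ℝ) (hc : ∀ ν, Continuous (D ν))
    (hd : ∀ ν z j, (∀ i, z i ∈ Icc (-(1 / 2) : ℝ) (1 / 2)) → z j ∈ Ioo (-(1 / 2) : ℝ) (1 / 2) →
      HasDerivAt (fun t => D ν (Function.update z j t))
        (D (Function.update ν j (ν j + 1)) z) (z j))
    (h0 : ∀ ν z j, (∀ i, z i ∈ Icc (-(1 / 2) : ℝ) (1 / 2)) → ν j = 0 → z j = 0 → D ν z = 0)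
    (z : Fin n → ℝ) (hz : ∀ j, z j ∈ Icc (-(1 / 2) : ℝ) (1 / 2)) :
    ∫ e, (∏ j, feat α (z j) (e j)) * D (fun j => (e j).1) (fun j => (e j).2)
      ∂Measure.pi (fun _ : Fin n => featMeasure α) = D 0 z := by
  induction n with
  | zero =>
    rw [Measure.pi_of_empty, integral_dirac]
    simp only [Finset.univ_eq_empty, Finset.prod_empty, one_mul]
    congr 1
    · exact Subsingleton.elim _ _
    · exact Subsingleton.elim _ _
  | succ n ih =>
    have hmem : ∀ {x : ℝ} {y : Fin n → ℝ}, x ∈ Icc (-(1 / 2) : ℝ) (1 / 2) →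
        (∀ i, y i ∈ Icc (-(1 / 2) : ℝ) (1 / 2)) →
        ∀ i, (Fin.cons x y : Fin (n + 1) → ℝ) i ∈ Icc (-(1 / 2) : ℝ) (1 / 2) := by
      intro x y hx hy i
      refine Fin.cases ?_ (fun i => ?_) i
      · simpa using hx
      · simpa using hy i
    have hcons : ∀ (r : ℕ) (x : ℝ) (ν : Fin n → ℕ), Continuous fun y : Fin n → ℝ =>
        D (Fin.cons r ν) (Fin.cons x y) := fun r x ν => (hc _).comp (by fun_prop)
    -- the formula in the last `n` variables
    have htail : ∫ e, (∏ j, feat α (z (Fin.succ j)) (e j)) *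
        D (Fin.cons 0 fun j => (e j).1) (Fin.cons (z 0) fun j => (e j).2)
        ∂Measure.pi (fun _ : Fin n => featMeasure α) = D 0 z := by
      have := ih (fun ν y => D (Fin.cons 0 ν) (Fin.cons (z 0) y)) (hcons 0 (z 0))
        (fun ν y j hy hj => by
          have h1 := hd (Fin.cons 0 ν) (Fin.cons (z 0) y) (Fin.succ j) (hmem (hz 0) hy)
            (by simpa using hj)
          simpa only [Fin.cons_succ, ← Fin.cons_update] using h1)
        (fun ν y j hy hν hj => h0 _ _ (Fin.succ j) (hmem (hz 0) hy) (by simpa using hν)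
          (by simpa using hj)) (fun j => z (Fin.succ j)) (fun j => hz _)
      rw [this]
      congr 1
      · ext i
        refine Fin.cases rfl (fun i => rfl) i
      · exact Fin.cons_self_tail z
    have hsymm : ∀ p : (ℕ × ℝ) × (Fin n → ℕ × ℝ),
        (MeasurableEquiv.piFinSuccAbove (fun _ : Fin (n + 1) => ℕ × ℝ) 0).symm p =
          Fin.cons p.1 p.2 := fun p => by
      ext i <;> refine Fin.cases rfl (fun i => rfl) i
    have hmp := (measurePreserving_piFinSuccAbove (fun _ : Fin (n + 1) => featMeasure α) 0).symm
    have hint := (hmp.integrable_comp_emb (MeasurableEquiv.measurableEmbedding _)).2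
      (integrable_prod_feat_mul hα hc hz)
    -- Fubini with the last `n` variables outside: for almost every choice of their orders and
    -- points, the one-variable formula collapses the integral over the first variable, leaving the
    -- integrand of `htail`.
    rw [← hmp.integral_comp']
    refine (integral_prod_symm _ hint).trans ?_
    rw [← htail]
    refine integral_congr_ae ?_
    filter_upwards [ae_pi_featMeasure hα] with e he
    have h1 : ∀ (r : ℕ) (ν : Fin n → ℕ) (k : ℕ),
        Function.update (Fin.cons r ν : Fin (n + 1) → ℕ) 0 k = Fin.cons k ν :=
      fun r ν k => Fin.update_cons_zero _ _ _
    have h2 := integral_feat_mul (α := α) hα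
      (d := fun r t => D (Fin.cons r fun j => (e j).1) (Fin.cons t fun j => (e j).2))
      (fun r => (hc _).comp (by fun_prop))
      (fun r t ht => by
        have h3 := hd (Fin.cons r fun j => (e j).1) (Fin.cons t fun j => (e j).2) 0
          (hmem (Ioo_subset_Icc_self ht) fun j => (he j).2.2) (by simpa using ht)
        simpa only [Fin.update_cons_zero, Fin.cons_zero] using h3)
      (h0 _ _ 0 (hmem (by norm_num) fun j => (he j).2.2) (by simp) (by simp)) (hz 0)
    rw [← h2, ← integral_const_mul]
    refine integral_congr_ae (Filter.Eventually.of_forall fun x => ?_)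
    have h3 : ∀ i, (Fin.cons x e : Fin (n + 1) → ℕ × ℝ) i =
        ((Fin.cons x.1 (fun j => (e j).1) : Fin (n + 1) → ℕ) i,
          (Fin.cons x.2 (fun j => (e j).2) : Fin (n + 1) → ℝ) i) := by
      refine Fin.cases (by simp) fun i => by simp
    simp only [Function.comp_apply, hsymm, Fin.prod_univ_succ, Fin.cons_zero, Fin.cons_succ]
    simp only [h3]
    ring

/-- The anchored Taylor formula in several variables, indexed by a finite type. -/
theorem integral_prod_feat_mul {ι : Type*} [Fintype ι] [DecidableEq ι] {α : ℕ} (hα : 1 ≤ α)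
    (D : (ι → ℕ) → (ι → ℝ) → ℝ) (hc : ∀ ν, Continuous (D ν))
    (hd : ∀ ν z j, (∀ i, z i ∈ Icc (-(1 / 2) : ℝ) (1 / 2)) → z j ∈ Ioo (-(1 / 2) : ℝ) (1 / 2) →
      HasDerivAt (fun t => D ν (Function.update z j t))
        (D (Function.update ν j (ν j + 1)) z) (z j))
    (h0 : ∀ ν z j, (∀ i, z i ∈ Icc (-(1 / 2) : ℝ) (1 / 2)) → ν j = 0 → z j = 0 → D ν z = 0)
    (z : ι → ℝ) (hz : ∀ j, z j ∈ Icc (-(1 / 2) : ℝ) (1 / 2)) :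
    ∫ e, (∏ j, feat α (z j) (e j)) * D (fun j => (e j).1) (fun j => (e j).2)
      ∂Measure.pi (fun _ : ι => featMeasure α) = D 0 z := by
  let σ := (Fintype.equivFin ι).symm
  have hupd : ∀ {β : Type} (w : Fin (Fintype.card ι) → β) (j : Fin (Fintype.card ι)) (t : β),
      (Function.update w j t) ∘ σ.symm = Function.update (w ∘ σ.symm) (σ j) t := fun w j t => by
    rw [Function.update_comp_equiv]
    simp
  have h := integral_prod_feat_mul_fin hα (Fintype.card ι)
    (fun ν y => D (ν ∘ σ.symm) (y ∘ σ.symm))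
    (fun ν => (hc _).comp (by fun_prop))
    (fun ν y j hy hj => by
      simpa only [hupd, Function.comp, Equiv.symm_apply_apply] using
        hd (ν ∘ σ.symm) (y ∘ σ.symm) (σ j) (fun i => hy _) (by simpa using hj))
    (fun ν y j hy hν hj => h0 _ _ (σ j) (fun i => hy _) (by simpa using hν) (by simpa using hj))
    (z ∘ σ) (fun j => hz _)
  rw [← (measurePreserving_piCongrLeft (fun _ => featMeasure α) σ).integral_comp']
  have h1 : ∀ (e : Fin (Fintype.card ι) → ℕ × ℝ) (j : ι),
      (MeasurableEquiv.piCongrLeft (fun _ => ℕ × ℝ) σ) e j = e (σ.symm j) := fun e j => by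
    obtain ⟨i, rfl⟩ := σ.surjective j
    rw [MeasurableEquiv.coe_piCongrLeft, Equiv.piCongrLeft_apply_apply, Equiv.symm_apply_apply]
  simp only [h1]
  convert h using 1
  · refine integral_congr_ae (Filter.Eventually.of_forall fun e => ?_)
    simp only [← σ.prod_comp, Equiv.symm_apply_apply, Function.comp_def]
  · congr 1
    ext j
    simp

/-! ### Membership in the anchored space -/

theorem integral_featMeasure_fst {α : ℕ} (hα : 1 ≤ α) (c : ℕ → ℝ) :
    Integrable (fun e => c e.1) (featMeasure α) ∧
    ∫ e, c e.1 ∂featMeasure α = ∑ r ∈ Finset.Icc 1 α, c r := by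
  obtain ⟨h1, h2⟩ := integral_featMeasure α (fun e => c e.1)
    (measurable_from_prod_countable_right fun r => measurable_const (a := c r))
    (∑ r ∈ Finset.Icc 1 α, |c r|) (by
      filter_upwards [ae_featMeasure hα] with e he
      exact Finset.single_le_sum (f := fun r => |c r|) (fun _ _ => abs_nonneg _) he.2.1)
  refine ⟨h1, ?_⟩
  rw [h2, ← Finset.Ico_insert_right hα, Finset.sum_insert (by simp)]
  norm_num
  ring

/-- Membership in the anchored space, with a bound for the norm, from bounds for the mixed
derivatives `D ν`. -/
theorem exists_anchoredRKHS {α : ℕ} (hα : 1 ≤ α) (s : Finset ℕ)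
    (D : (s → ℕ) → (s → ℝ) → ℝ) (hc : ∀ ν, Continuous (D ν))
    (hd : ∀ ν z j, (∀ i, z i ∈ Icc (-(1 / 2) : ℝ) (1 / 2)) → z j ∈ Ioo (-(1 / 2) : ℝ) (1 / 2) →
      HasDerivAt (fun t => D ν (Function.update z j t))
        (D (Function.update ν j (ν j + 1)) z) (z j))
    (h0 : ∀ ν z j, (∀ i, z i ∈ Icc (-(1 / 2) : ℝ) (1 / 2)) → ν j = 0 → z j = 0 → D ν z = 0)
    (M : ℝ) (hM : 0 ≤ M) (c : ℕ → ℝ)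
    (hbd : ∀ ν z, (∀ j, ν j ∈ Finset.Icc 1 α) → (∀ i, z i ∈ Icc (-(1 / 2) : ℝ) (1 / 2)) →
      |D ν z| ≤ M * ∏ j, c (ν j)) :
    ∃ F : AnchoredRKHS α s, (∀ z : Cube s, F z = D 0 fun j => (z j : ℝ)) ∧
      ‖F‖ ≤ M * √((∑ r ∈ Finset.Icc 1 α, c r ^ 2) ^ s.card) := by
  let μ := Measure.pi (fun _ : s => featMeasure α)
  have hΦ : ∀ z : Cube s, MemLp (fun e : s → ℕ × ℝ => ∏ j, feat α (z j) (e j)) 2 μ := fun z => by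
    refine MemLp.of_bound (measurable_pi_feat _).aestronglyMeasurable 1 ?_
    filter_upwards [ae_pi_featMeasure hα] with e he
    exact abs_prod_feat_le_one (fun j => (z j).2) fun j => (he j).2.2
  obtain ⟨C, hC⟩ := exists_bound_family hc α
  -- The representing element of `L²`: at `e`, the derivative of orders `(e j).1` at the point with
  -- coordinates `(e j).2`.
  have hh : MemLp (fun e : s → ℕ × ℝ => D (fun j => (e j).1) fun j => (e j).2) 2 μ := by
    refine MemLp.of_bound (continuous_family hc).aestronglyMeasurable C ?_
    filter_upwards [ae_pi_featMeasure hα] with e he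
    exact hC _ (fun j => (he j).2.1) _ fun j => (he j).2.2
  have hker : ∀ x y : Cube s, RKHS.kernel (AnchoredRKHS α s) x y 1 =
      inner ℝ ((hΦ x).toLp _) ((hΦ y).toLp _) := fun x y => by
    rw [RKHS.OfKernel.kernel_ofKernel, L2.inner_def]
    have h1 : ∫ e, inner ℝ ((hΦ x).toLp _ e) ((hΦ y).toLp _ e) ∂μ =
        ∫ e, ∏ j, (feat α (x j) (e j) * feat α (y j) (e j)) ∂μ := by
      refine integral_congr_ae ?_
      filter_upwards [(hΦ x).coeFn_toLp, (hΦ y).coeFn_toLp] with e hx hy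
      rw [hx, hy, Finset.prod_mul_distrib]
      simp [mul_comm]
    rw [h1, integral_fintype_prod_eq_prod (fun j e => feat α (x j) e * feat α (y j) e)]
    simp only [← kernel1_eq_integral hα (x _).2 (y _).2]
    simp [anchoredKernel]
  obtain ⟨F, hF, hFn⟩ := exists_rkhs_of_feature (H := AnchoredRKHS α s)
    (fun z : Cube s => (hΦ z).toLp _) hker (hh.toLp _)
  refine ⟨F, fun z => ?_, hFn.trans ?_⟩
  · rw [hF, L2.inner_def, ← integral_prod_feat_mul hα D hc hd h0 (fun j => (z j : ℝ))
      fun j => (z j).2]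
    refine integral_congr_ae ?_
    filter_upwards [(hΦ z).coeFn_toLp, hh.coeFn_toLp] with e hx hy
    rw [hx, hy]
    simp [mul_comm]
  · have hcs : 0 ≤ ∑ r ∈ Finset.Icc 1 α, c r ^ 2 := Finset.sum_nonneg fun _ _ => sq_nonneg _
    rw [← abs_of_nonneg (norm_nonneg (hh.toLp _)), ← abs_of_nonneg (mul_nonneg hM (Real.sqrt_nonneg
      ((∑ r ∈ Finset.Icc 1 α, c r ^ 2) ^ s.card))), ← sq_le_sq, mul_pow,
      Real.sq_sqrt (pow_nonneg hcs _), ← real_inner_self_eq_norm_sq, L2.inner_def]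
    -- The dominating function is a product of functions of the single orders, so its integral is a
    -- power of a one-variable sum.
    have h2 : ∫ e, M ^ 2 * ∏ j : s, c (e j).1 ^ 2 ∂μ =
        M ^ 2 * (∑ r ∈ Finset.Icc 1 α, c r ^ 2) ^ s.card := by
      rw [integral_const_mul, integral_fintype_prod_eq_prod
        (fun (_ : s) (e : ℕ × ℝ) => c e.1 ^ 2)]
      simp [(integral_featMeasure_fst hα fun r => c r ^ 2).2]
    rw [← h2]
    refine integral_mono_ae (L2.integrable_inner _ _) (Integrable.const_mul
      (Integrable.fintype_prod fun _ => (integral_featMeasure_fst hα fun r => c r ^ 2).1) _) ?_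
    filter_upwards [ae_pi_featMeasure hα, hh.coeFn_toLp] with e he hy
    rw [hy, real_inner_self_eq_norm_sq, Finset.prod_pow, ← mul_pow, Real.norm_eq_abs]
    exact pow_le_pow_left₀ (abs_nonneg _)
      (hbd _ _ (fun j => (he j).2.1) fun j => (he j).2.2) 2

/-! ### Affine families of operators -/

/-- The affine operator family `A₀ + ∑_j z_j A_j`. -/
def affineOp {W ι : Type*} [NormedAddCommGroup W] [InnerProductSpace ℝ W] [Fintype ι]
    (A₀ : W →L[ℝ] W) (A : ι → W →L[ℝ] W) (z : ι → ℝ) : W →L[ℝ] W := A₀ + ∑ j, z j • A j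

/-- The recursion for the derivatives of the solution, with the order as recursion variable. -/
def solDerivAux {W ι : Type*} [NormedAddCommGroup W] [InnerProductSpace ℝ W] [Fintype ι]
    [DecidableEq ι] (A₀ : W →L[ℝ] W) (A : ι → W →L[ℝ] W) (f : W) : ℕ → (ι → ℕ) → (ι → ℝ) → W
  | 0, _, z => Ring.inverse (affineOp A₀ A z) f
  | k + 1, ν, z => -Ring.inverse (affineOp A₀ A z)
      (∑ j, (ν j : ℝ) • A j (solDerivAux A₀ A f k (Function.update ν j (ν j - 1)) z))

/-- The derivative `∂^ν` of the solution `(A₀ + ∑_j z_j A_j)⁻¹ f`. -/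
def solDeriv {W ι : Type*} [NormedAddCommGroup W] [InnerProductSpace ℝ W] [Fintype ι]
    [DecidableEq ι] (A₀ : W →L[ℝ] W) (A : ι → W →L[ℝ] W) (f : W) (ν : ι → ℕ) (z : ι → ℝ) : W :=
  solDerivAux A₀ A f (∑ j, ν j) ν z

theorem sum_update_pred {ι : Type*} [Fintype ι] [DecidableEq ι] {ν : ι → ℕ} {j : ι}
    (hj : ν j ≠ 0) : (∑ i, Function.update ν j (ν j - 1) i) + 1 = ∑ i, ν i := by
  rw [Finset.sum_update_of_mem (Finset.mem_univ j), ← Finset.add_sum_erase _ ν (Finset.mem_univ j),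
    Finset.sdiff_singleton_eq_erase]
  omega

theorem sum_update_succ {ι : Type*} [Fintype ι] [DecidableEq ι] (ν : ι → ℕ) (j : ι) :
    ∑ i, Function.update ν j (ν j + 1) i = (∑ i, ν i) + 1 := by
  rw [Finset.sum_update_of_mem (Finset.mem_univ j), ← Finset.add_sum_erase _ ν (Finset.mem_univ j),
    Finset.sdiff_singleton_eq_erase]
  omega

section Operators

variable {W ι : Type*} [NormedAddCommGroup W] [InnerProductSpace ℝ W]
  [Fintype ι] {A₀ : W →L[ℝ] W} {A : ι → W →L[ℝ] W} {f : W}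

theorem continuous_affineOp : Continuous (affineOp A₀ A) := by
  unfold affineOp
  fun_prop

theorem contDiff_affineOp {n : WithTop ℕ∞} : ContDiff ℝ n (affineOp A₀ A) := by
  unfold affineOp
  fun_prop

variable [DecidableEq ι]

theorem solDeriv_zero (z : ι → ℝ) :
    solDeriv A₀ A f 0 z = Ring.inverse (affineOp A₀ A z) f := by
  simp [solDeriv, solDerivAux]

theorem solDeriv_of_ne_zero {ν : ι → ℕ} (hν : ν ≠ 0) (z : ι → ℝ) :
    solDeriv A₀ A f ν z = -Ring.inverse (affineOp A₀ A z)
      (∑ j, (ν j : ℝ) • A j (solDeriv A₀ A f (Function.update ν j (ν j - 1)) z)) := by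
  obtain ⟨i, hi⟩ := Function.ne_iff.1 hν
  obtain ⟨k, hk⟩ : ∃ k, ∑ j, ν j = k + 1 := ⟨_, (sum_update_pred hi).symm⟩
  rw [solDeriv, hk, solDerivAux]
  congr 2
  refine Finset.sum_congr rfl fun j _ => ?_
  -- Truncated subtraction does not lower the order here, but the term has coefficient zero.
  by_cases hj : ν j = 0
  · simp [hj]
  · have := sum_update_pred hj
    rw [solDeriv, show ∑ i, Function.update ν j (ν j - 1) i = k by omega]

/-- One copy of `A j (∂^ν u)` is split off from the coefficient `ν j + 1`, which gives the recursion
the shape in which the product rule delivers it. -/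
theorem solDeriv_update_succ (ν : ι → ℕ) (j : ι) (z : ι → ℝ) :
    solDeriv A₀ A f (Function.update ν j (ν j + 1)) z = -Ring.inverse (affineOp A₀ A z)
      (A j (solDeriv A₀ A f ν z) + ∑ i, (ν i : ℝ) • A i (solDeriv A₀ A f (Function.update
        (Function.update ν i (ν i - 1)) j (Function.update ν i (ν i - 1) j + 1)) z)) := by
  have hne : Function.update ν j (ν j + 1) ≠ 0 := fun h => by simpa using congrFun h j
  rw [solDeriv_of_ne_zero hne]
  congr 2
  have h1 : A j (solDeriv A₀ A f ν z) =
      ∑ i, if i = j then A j (solDeriv A₀ A f ν z) else 0 := by simp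
  rw [h1, ← Finset.sum_add_distrib]
  refine Finset.sum_congr rfl fun i _ => ?_
  by_cases hij : i = j
  · subst hij
    by_cases hi : ν i = 0
    · have h2 : Function.update ν i 0 = ν := by rw [← hi]; simp
      simp [hi, h2]
    · simp only [Function.update_self, Function.update_idem, Nat.add_sub_cancel, if_true,
        Nat.sub_add_cancel (Nat.one_le_iff_ne_zero.2 hi), Function.update_eq_self]
      push_cast
      module
  · simp only [Function.update_of_ne hij, Function.update_of_ne (Ne.symm hij), if_neg hij, zero_add]
    rw [Function.update_comm hij]

theorem hasDerivAt_affineOp_update (z : ι → ℝ) (j : ι) :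
    HasDerivAt (fun t => affineOp A₀ A (Function.update z j t)) (A j) (z j) := by
  have h : (fun t => affineOp A₀ A (Function.update z j t)) = fun t =>
      affineOp A₀ A z + (t - z j) • A j := by
    funext t
    simp only [affineOp]
    rw [← Finset.add_sum_erase _ (fun i => z i • A i) (Finset.mem_univ j),
      ← Finset.add_sum_erase _ _ (Finset.mem_univ j)]
    have : ∑ i ∈ Finset.univ.erase j, Function.update z j t i • A i =
        ∑ i ∈ Finset.univ.erase j, z i • A i :=
      Finset.sum_congr rfl fun i hi => by rw [Function.update_of_ne (Finset.ne_of_mem_erase hi)]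
    rw [this, Function.update_self]
    module
  rw [h]
  simpa using (((hasDerivAt_id (z j)).sub_const (z j)).smul_const (A j)).const_add
    (affineOp A₀ A z)

variable [CompleteSpace W]

theorem hasDerivAt_inverse_affineOp_update {z : ι → ℝ} (hz : IsUnit (affineOp A₀ A z)) (j : ι) :
    HasDerivAt (fun t => Ring.inverse (affineOp A₀ A (Function.update z j t)))
      (-(Ring.inverse (affineOp A₀ A z) * A j * Ring.inverse (affineOp A₀ A z))) (z j) := by
  obtain ⟨x, hx⟩ := hz
  have h1 := hasFDerivAt_ringInverse (𝕜 := ℝ) x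
  have h2 : affineOp A₀ A (Function.update z j (z j)) = x := by rw [Function.update_eq_self, hx]
  rw [← h2] at h1
  have h3 := h1.comp_hasDerivAt (z j) (hasDerivAt_affineOp_update (A₀ := A₀) (A := A) z j)
  refine h3.congr_deriv ?_
  rw [← hx, Ring.inverse_unit]
  simp

/-- Induction on `|ν|`, by the product rule for `∂^ν u = -R g`, with `R` the inverse operator and
`g` the sum in the recursion. Since `R' = -R A_j R`, differentiating `R` gives `-R A_j ∂^ν u`, while
`g'` is known by induction. -/
theorem hasDerivAt_solDeriv {z : ι → ℝ} (hz : IsUnit (affineOp A₀ A z)) (ν : ι → ℕ) (j : ι) :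
    HasDerivAt (fun t => solDeriv A₀ A f ν (Function.update z j t))
      (solDeriv A₀ A f (Function.update ν j (ν j + 1)) z) (z j) := by
  have hR := hasDerivAt_inverse_affineOp_update hz j
  induction hk : ∑ i, ν i generalizing ν with
  | zero =>
    have hν : ν = 0 := by
      funext i
      exact (Finset.sum_eq_zero_iff.1 hk) i (Finset.mem_univ i)
    subst hν
    simp only [solDeriv_zero]
    refine (hR.clm_apply (hasDerivAt_const (z j) f)).congr_deriv ?_
    rw [solDeriv_update_succ]
    simp [solDeriv_zero]
  | succ k ih =>
    have hν : ν ≠ 0 := by rintro rfl; simp at hk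
    have hg : HasDerivAt (fun t => ∑ i, (ν i : ℝ) •
        A i (solDeriv A₀ A f (Function.update ν i (ν i - 1)) (Function.update z j t)))
        (∑ i, (ν i : ℝ) • A i (solDeriv A₀ A f (Function.update
          (Function.update ν i (ν i - 1)) j (Function.update ν i (ν i - 1) j + 1)) z)) (z j) := by
      refine HasDerivAt.fun_sum fun i _ => ?_
      by_cases hi : ν i = 0
      · simpa [hi] using hasDerivAt_const (z j) (0 : W)
      · refine HasDerivAt.const_smul _ ((A i).hasFDerivAt.comp_hasDerivAt (z j) (ih _ ?_))
        have := sum_update_pred hi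
        omega
    have h1 := (hR.clm_apply hg).neg
    have h2 : (fun t => solDeriv A₀ A f ν (Function.update z j t)) = fun t =>
        -Ring.inverse (affineOp A₀ A (Function.update z j t)) (∑ i, (ν i : ℝ) •
          A i (solDeriv A₀ A f (Function.update ν i (ν i - 1)) (Function.update z j t))) :=
      funext fun t => solDeriv_of_ne_zero hν _
    rw [h2]
    refine h1.congr_deriv ?_
    rw [solDeriv_update_succ, solDeriv_of_ne_zero hν]
    simp only [Function.update_eq_self, neg_apply, mul_apply_eq_comp, map_neg, map_add]

theorem contDiffAt_solDeriv_zero {z : ι → ℝ} (hz : IsUnit (affineOp A₀ A z)) :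
    ContDiffAt ℝ ∞ (solDeriv A₀ A f 0) z := by
  obtain ⟨x, hx⟩ := hz
  have h1 : ContDiffAt ℝ ∞ (fun z => Ring.inverse (affineOp A₀ A z)) z := by
    have h2 : ContDiffAt ℝ ∞ Ring.inverse (affineOp A₀ A z) := hx ▸ contDiffAt_ringInverse ℝ x
    exact h2.comp z contDiff_affineOp.contDiffAt
  have h3 : solDeriv A₀ A f 0 = fun z => Ring.inverse (affineOp A₀ A z) f :=
    funext solDeriv_zero
  rw [h3]
  exact h1.clm_apply contDiffAt_const

theorem continuousAt_solDeriv {z : ι → ℝ} (hz : IsUnit (affineOp A₀ A z)) (ν : ι → ℕ) :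
    ContinuousAt (solDeriv A₀ A f ν) z := by
  have hR : ContinuousAt (fun z => Ring.inverse (affineOp A₀ A z)) z := by
    obtain ⟨x, hx⟩ := hz
    have h2 : ContinuousAt Ring.inverse (affineOp A₀ A z) := hx ▸ NormedRing.inverse_continuousAt x
    exact h2.comp continuous_affineOp.continuousAt
  induction hk : ∑ i, ν i generalizing ν with
  | zero =>
    have hν : ν = 0 := by
      funext i
      exact (Finset.sum_eq_zero_iff.1 hk) i (Finset.mem_univ i)
    subst hν
    exact (contDiffAt_solDeriv_zero hz).continuousAt
  | succ k ih =>
    have hν : ν ≠ 0 := by rintro rfl; simp at hk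
    rw [funext (solDeriv_of_ne_zero hν)]
    refine (hR.clm_apply ?_).neg
    refine tendsto_finsetSum _ fun i _ => ?_
    by_cases hi : ν i = 0
    · simp [hi]
    · refine ((A i).continuous.continuousAt.comp (ih _ ?_)).const_smul _
      have := sum_update_pred hi
      omega

end Operators

/-! ### Energy estimates -/

/-- The Lax–Milgram theorem for operators. -/
theorem isUnit_of_coercive {W : Type*} [NormedAddCommGroup W] [InnerProductSpace ℝ W]
    [CompleteSpace W] {T : W →L[ℝ] W} {c : ℝ} (hc : 0 < c)
    (hT : ∀ p, c * ‖p‖ ^ 2 ≤ inner ℝ (T p) p) : IsUnit T := by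
  let B : W →L[ℝ] W →L[ℝ] ℝ := (innerSL ℝ).comp T
  have hB : IsCoercive B := ⟨c, hc, fun p => by
    have := hT p
    simpa [B, pow_two, mul_assoc] using this⟩
  have h1 : T = (hB.continuousLinearEquivOfBilin : W →L[ℝ] W) := by
    ext p
    refine ext_inner_right ℝ fun q => ?_
    have := hB.continuousLinearEquivOfBilin_apply p q
    simp only [B] at this
    exact this.symm
  rw [h1]
  exact ⟨ContinuousLinearEquiv.toUnit hB.continuousLinearEquivOfBilin, rfl⟩

/-- The structural hypotheses under which the affine family is uniformly coercive on the cube: `Q j`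
dominates the form of `A j`, and the weighted sum of the `Q j` is dominated by the form of `A₀`. -/
structure EnergyBound {W ι : Type*} [NormedAddCommGroup W] [InnerProductSpace ℝ W] [Fintype ι]
    (A₀ : W →L[ℝ] W) (A : ι → W →L[ℝ] W) (Q : ι → W → ℝ) (b : ι → ℝ) (κ m : ℝ) : Prop where
  b_pos : ∀ j, 0 < b j
  b_le_one : ∀ j, b j ≤ 1
  κ_pos : 0 < κ
  κ_lt_one : κ < 1
  m_pos : 0 < m
  abs_inner_le : ∀ j p q t, 0 < t → |inner ℝ (A j p) q| ≤ (t * Q j p + Q j q / t) / 2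
  sum_le : ∀ p, ∑ j, Q j p / b j ≤ 2 * κ * inner ℝ (A₀ p) p
  le_inner : ∀ p, m * ‖p‖ ^ 2 ≤ inner ℝ (A₀ p) p

/-- The factor `(ν_j! b_j^{ν_j})_j` normalising the derivatives. -/
def scaleFactor {ι : Type*} [Fintype ι] (b : ι → ℝ) (ν : ι → ℕ) : ℝ :=
  ∏ j, ((ν j).factorial : ℝ) * b j ^ ν j

theorem scaleFactor_pos {ι : Type*} [Fintype ι] {b : ι → ℝ} (hb : ∀ j, 0 < b j) (ν : ι → ℕ) :
    0 < scaleFactor b ν :=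
  Finset.prod_pos fun j _ =>
    mul_pos (by exact_mod_cast (ν j).factorial_pos) (pow_pos (hb j) _)

theorem scaleFactor_pred {ι : Type*} [Fintype ι] [DecidableEq ι] (b : ι → ℝ) {ν : ι → ℕ} {j : ι}
    (hj : ν j ≠ 0) :
    scaleFactor b ν = ν j * b j * scaleFactor b (Function.update ν j (ν j - 1)) := by
  unfold scaleFactor
  rw [← Finset.mul_prod_erase _ _ (Finset.mem_univ j), ← Finset.mul_prod_erase Finset.univ
    (fun i => ((Function.update ν j (ν j - 1) i).factorial : ℝ) * b i ^ _) (Finset.mem_univ j)]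
  have h1 : ∏ i ∈ Finset.univ.erase j, ((Function.update ν j (ν j - 1) i).factorial : ℝ) *
      b i ^ Function.update ν j (ν j - 1) i = ∏ i ∈ Finset.univ.erase j,
        ((ν i).factorial : ℝ) * b i ^ ν i :=
    Finset.prod_congr rfl fun i hi => by rw [Function.update_of_ne (Finset.ne_of_mem_erase hi)]
  rw [h1, Function.update_self]
  obtain ⟨k, hk⟩ := Nat.exists_eq_succ_of_ne_zero hj
  rw [hk, Nat.factorial_succ]
  push_cast
  simp only [Nat.succ_eq_add_one]
  ring

/-- Lowering the `j`-th entry is a bijection from the multi-indices of order `k + 1` with positive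
`j`-th entry onto those of order `k`. Thus each index of order `k` is charged once per direction,
and no combinatorial factor enters the energy estimate. -/
theorem sum_piAntidiag_pred {ι : Type*} [Fintype ι] [DecidableEq ι] (k : ℕ) (j : ι)
    (g : (ι → ℕ) → ℝ) :
    ∑ ν ∈ Finset.piAntidiag Finset.univ (k + 1),
      (if ν j = 0 then 0 else g (Function.update ν j (ν j - 1))) =
    ∑ ν ∈ Finset.piAntidiag Finset.univ k, g ν := by
  have h : ∀ ν : ι → ℕ, (if ν j = 0 then 0 else g (Function.update ν j (ν j - 1))) =
      if ν j ≠ 0 then g (Function.update ν j (ν j - 1)) else 0 := fun ν => by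
    by_cases hν : ν j = 0 <;> simp [hν]
  simp only [h]
  rw [← Finset.sum_filter]
  refine Finset.sum_nbij' (fun ν => Function.update ν j (ν j - 1))
    (fun ν => Function.update ν j (ν j + 1)) ?_ ?_ ?_ ?_ ?_
  · intro ν hν
    simp only [Finset.mem_filter, Finset.mem_piAntidiag] at hν ⊢
    have : Finset.univ.sum (Function.update ν j (ν j - 1)) + 1 = Finset.univ.sum ν :=
      sum_update_pred hν.2
    exact ⟨by omega, by simp⟩
  · intro ν hν
    simp only [Finset.mem_filter, Finset.mem_piAntidiag] at hν ⊢
    have : Finset.univ.sum (Function.update ν j (ν j + 1)) = Finset.univ.sum ν + 1 :=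
      sum_update_succ ν j
    exact ⟨⟨by omega, by simp⟩, by simp⟩
  · intro ν hν
    simp only [Finset.mem_filter] at hν
    simp [Nat.sub_add_cancel (Nat.one_le_iff_ne_zero.2 hν.2)]
  · intro ν _
    simp
  · intro ν _
    rfl

namespace EnergyBound

variable {W ι : Type*} [NormedAddCommGroup W] [InnerProductSpace ℝ W] [Fintype ι]
  {A₀ : W →L[ℝ] W} {A : ι → W →L[ℝ] W} {Q : ι → W → ℝ} {b : ι → ℝ} {κ m : ℝ}

theorem Q_nonneg (h : EnergyBound A₀ A Q b κ m) (j : ι) (p : W) : 0 ≤ Q j p := by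
  have h1 := h.abs_inner_le j p p 1 one_pos
  have h2 := abs_nonneg (inner ℝ (A j p) p)
  linarith

/-- As `|z j| ≤ 1/2` and `b j ≤ 1`, the perturbation costs at most half of `∑ Q j p / b j`, that is,
`κ` times the form of `A₀`. -/
theorem one_sub_mul_inner_le (h : EnergyBound A₀ A Q b κ m) {z : ι → ℝ}
    (hz : ∀ j, z j ∈ Icc (-(1 / 2) : ℝ) (1 / 2)) (p : W) :
    (1 - κ) * inner ℝ (A₀ p) p ≤ inner ℝ (affineOp A₀ A z p) p := by
  have h1 : inner ℝ (affineOp A₀ A z p) p =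
      inner ℝ (A₀ p) p + ∑ j, z j * inner ℝ (A j p) p := by
    simp [affineOp, inner_add_left, sum_inner, real_inner_smul_left]
  have h2 : ∀ j, -(Q j p / b j / 2) ≤ z j * inner ℝ (A j p) p := fun j => by
    have h3 : |inner ℝ (A j p) p| ≤ Q j p := by
      have := h.abs_inner_le j p p 1 one_pos
      linarith
    have h4 : Q j p ≤ Q j p / b j :=
      le_div_self (h.Q_nonneg j p) (h.b_pos j) (h.b_le_one j)
    have h5 : |z j * inner ℝ (A j p) p| ≤ 1 / 2 * (Q j p / b j) := by
      rw [abs_mul]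
      exact mul_le_mul (abs_le.2 ⟨by linarith [(hz j).1], (hz j).2⟩) (h3.trans h4)
        (abs_nonneg _) (by norm_num)
    linarith [neg_abs_le (z j * inner ℝ (A j p) p)]
  have h6 := Finset.sum_le_sum fun j (_ : j ∈ Finset.univ) => h2 j
  rw [Finset.sum_neg_distrib, ← Finset.sum_div] at h6
  have := h.sum_le p
  rw [h1]
  linarith

theorem mul_norm_sq_le (h : EnergyBound A₀ A Q b κ m) {z : ι → ℝ}
    (hz : ∀ j, z j ∈ Icc (-(1 / 2) : ℝ) (1 / 2)) (p : W) :
    (1 - κ) * m * ‖p‖ ^ 2 ≤ inner ℝ (affineOp A₀ A z p) p := by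
  refine le_trans ?_ (h.one_sub_mul_inner_le hz p)
  rw [mul_assoc]
  exact mul_le_mul_of_nonneg_left (h.le_inner p) (by linarith [h.κ_lt_one])

theorem isUnit [CompleteSpace W] (h : EnergyBound A₀ A Q b κ m) {z : ι → ℝ}
    (hz : ∀ j, z j ∈ Icc (-(1 / 2) : ℝ) (1 / 2)) : IsUnit (affineOp A₀ A z) :=
  isUnit_of_coercive (mul_pos (by linarith [h.κ_lt_one]) h.m_pos) (h.mul_norm_sq_le hz)

variable [DecidableEq ι]

/-- One step of the energy estimate, for the scaled derivatives `p` of a given order. -/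
theorem sum_inner_succ_le (h : EnergyBound A₀ A Q b κ m) {z : ι → ℝ}
    (hz : ∀ j, z j ∈ Icc (-(1 / 2) : ℝ) (1 / 2)) {p : (ι → ℕ) → W}
    (hp : ∀ ν ≠ 0, affineOp A₀ A z (p ν) = -∑ j, if ν j = 0 then 0 else
      (b j)⁻¹ • A j (p (Function.update ν j (ν j - 1)))) (k : ℕ) :
    ∑ ν ∈ Finset.piAntidiag Finset.univ (k + 1), inner ℝ (affineOp A₀ A z (p ν)) (p ν) ≤
      (2 * (κ / (1 - κ))) ^ 2 *
        ∑ ν ∈ Finset.piAntidiag Finset.univ k, inner ℝ (affineOp A₀ A z (p ν)) (p ν) := by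
  set θ := κ / (1 - κ) with hθ
  have h1κ : 0 < 1 - κ := by linarith [h.κ_lt_one]
  have hθ0 : 0 < θ := div_pos h.κ_pos h1κ
  -- Replacing the form of `A₀` by the form at `z` costs a factor `1 / (1 - κ)`, whence `θ`.
  have hQsum : ∀ q : W, ∑ j, Q j q / b j ≤ 2 * θ * inner ℝ (affineOp A₀ A z q) q := fun q => by
    refine (h.sum_le q).trans ?_
    have h2 := mul_le_mul_of_nonneg_left (h.one_sub_mul_inner_le hz q)
      (show 0 ≤ 2 * θ by positivity)
    refine le_trans (le_of_eq ?_) h2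
    rw [hθ]
    field_simp
  have hterm : ∀ ν ∈ Finset.piAntidiag (Finset.univ : Finset ι) (k + 1),
      inner ℝ (affineOp A₀ A z (p ν)) (p ν) ≤
        ∑ j, (if ν j = 0 then 0 else θ * (Q j (p (Function.update ν j (ν j - 1))) / b j)) +
          1 / (4 * θ) * ∑ j, Q j (p ν) / b j := by
    intro ν hν
    have hν0 : ν ≠ 0 := by
      rintro rfl
      simp [Finset.mem_piAntidiag] at hν
    nth_rewrite 1 [hp ν hν0]
    rw [inner_neg_left, sum_inner, ← Finset.sum_neg_distrib, Finset.mul_sum,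
      ← Finset.sum_add_distrib]
    refine Finset.sum_le_sum fun j _ => ?_
    have hQ := h.Q_nonneg j (p ν)
    have hbj := h.b_pos j
    split_ifs with hj
    · simp only [inner_zero_left, neg_zero, zero_add]
      positivity
    · have h2 := h.abs_inner_le j (p (Function.update ν j (ν j - 1))) (p ν) (2 * θ) (by positivity)
      have h3 := (neg_le_abs _).trans h2
      rw [real_inner_smul_left]
      calc -((b j)⁻¹ * inner ℝ (A j (p (Function.update ν j (ν j - 1)))) (p ν))
          = (b j)⁻¹ * -inner ℝ (A j (p (Function.update ν j (ν j - 1)))) (p ν) := by ring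
        _ ≤ (b j)⁻¹ * ((2 * θ * Q j (p (Function.update ν j (ν j - 1))) +
            Q j (p ν) / (2 * θ)) / 2) := mul_le_mul_of_nonneg_left h3 (by positivity)
        _ = _ := by field_simp; ring
  have hsum := Finset.sum_le_sum hterm
  rw [Finset.sum_add_distrib, Finset.sum_comm] at hsum
  rw [Finset.sum_congr rfl fun j _ => sum_piAntidiag_pred k j fun μ => θ * (Q j (p μ) / b j),
    Finset.sum_comm] at hsum
  simp only [← Finset.mul_sum] at hsum
  have h2 := Finset.sum_le_sum fun ν (_ : ν ∈ Finset.piAntidiag (Finset.univ : Finset ι) k) =>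
    hQsum (p ν)
  have h3 := Finset.sum_le_sum fun ν (_ : ν ∈ Finset.piAntidiag (Finset.univ : Finset ι) (k + 1)) =>
    hQsum (p ν)
  rw [← Finset.mul_sum] at h2 h3
  have h4 := mul_le_mul_of_nonneg_left h2 hθ0.le
  have h5 := mul_le_mul_of_nonneg_left h3 (show 0 ≤ 1 / (4 * θ) by positivity)
  have h6 : 1 / (4 * θ) * (2 * θ * ∑ ν ∈ Finset.piAntidiag (Finset.univ : Finset ι) (k + 1),
      inner ℝ (affineOp A₀ A z (p ν)) (p ν)) =
      1 / 2 * ∑ ν ∈ Finset.piAntidiag (Finset.univ : Finset ι) (k + 1),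
        inner ℝ (affineOp A₀ A z (p ν)) (p ν) := by
    field_simp
    ring
  rw [h6] at h5
  -- With `S_k` the energy sum of order `k`, the estimates combine to `S_{k+1} ≤ 2θ² S_k + S_{k+1} /
  -- 2`.
  nlinarith

variable [CompleteSpace W]

theorem affineOp_solDeriv_zero (h : EnergyBound A₀ A Q b κ m) {z : ι → ℝ}
    (hz : ∀ j, z j ∈ Icc (-(1 / 2) : ℝ) (1 / 2)) (f : W) :
    affineOp A₀ A z (solDeriv A₀ A f 0 z) = f := by
  rw [solDeriv_zero, ← mul_apply_eq_comp, Ring.mul_inverse_cancel _ (h.isUnit hz)]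
  rfl

/-- A single scaled derivative has at most the total energy of its order, and these totals decay
geometrically from the energy of the solution itself. Coercivity is used twice, for that first
energy and to return to the norm. -/
theorem norm_solDeriv_le (h : EnergyBound A₀ A Q b κ m) {z : ι → ℝ}
    (hz : ∀ j, z j ∈ Icc (-(1 / 2) : ℝ) (1 / 2)) (f : W) (ν : ι → ℕ) :
    ‖solDeriv A₀ A f ν z‖ ≤
      ‖f‖ / ((1 - κ) * m) * ∏ j, (((ν j).factorial : ℝ) * b j ^ ν j * (2 * (κ / (1 - κ))) ^ ν j) := by
  set a := affineOp A₀ A z with ha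
  set θ := κ / (1 - κ) with hθ
  have h1κ : 0 < 1 - κ := by linarith [h.κ_lt_one]
  have hθ0 : 0 < θ := div_pos h.κ_pos h1κ
  have hm := h.m_pos
  have hu := h.isUnit hz
  -- Dividing by `ν! b^ν` turns the coefficient `ν j` of the recursion into `(b j)⁻¹`, the weight in
  -- the hypothesis on `Q`.
  let p : (ι → ℕ) → W := fun ν => (scaleFactor b ν)⁻¹ • solDeriv A₀ A f ν z
  have hnonneg : ∀ q, 0 ≤ inner ℝ (a q) q := fun q =>
    le_trans (by positivity) (h.mul_norm_sq_le hz q)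
  have hp : ∀ ν ≠ 0, a (p ν) = -∑ j, if ν j = 0 then 0 else
      (b j)⁻¹ • A j (p (Function.update ν j (ν j - 1))) := by
    intro ν hν
    simp only [p, map_smul]
    rw [solDeriv_of_ne_zero hν, map_neg, ← mul_apply_eq_comp,
      Ring.mul_inverse_cancel _ hu, smul_neg, one_apply_eq_self, Finset.smul_sum]
    congr 1
    refine Finset.sum_congr rfl fun j _ => ?_
    split_ifs with hj
    · simp [hj]
    · have hνj : (ν j : ℝ) ≠ 0 := by exact_mod_cast hj
      have h1 := (scaleFactor_pos h.b_pos (Function.update ν j (ν j - 1))).ne'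
      have h2 := (h.b_pos j).ne'
      rw [scaleFactor_pred b hj, smul_smul, smul_smul]
      congr 1
      field_simp
  have hiter : ∀ k, ∑ ν ∈ Finset.piAntidiag Finset.univ k, inner ℝ (a (p ν)) (p ν) ≤
      ((2 * θ) ^ k) ^ 2 * inner ℝ f (p 0) := by
    intro k
    induction k with
    | zero =>
      have h1 : p 0 = solDeriv A₀ A f 0 z := by simp [p, scaleFactor]
      simp [h1, h.affineOp_solDeriv_zero hz, ha]
    | succ k ih =>
      refine (h.sum_inner_succ_le hz hp k).trans ?_
      refine (mul_le_mul_of_nonneg_left ih (sq_nonneg _)).trans (le_of_eq ?_)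
      ring
  have hp0 : a (p 0) = f := by
    have h1 : p 0 = solDeriv A₀ A f 0 z := by simp [p, scaleFactor]
    rw [h1, h.affineOp_solDeriv_zero hz]
  have hf0 : inner ℝ f (p 0) ≤ ‖f‖ ^ 2 / ((1 - κ) * m) := by
    have h1 := h.mul_norm_sq_le hz (p 0)
    rw [← ha, hp0] at h1
    have h2 := real_inner_le_norm f (p 0)
    rw [le_div_iff₀ (by positivity)]
    have h3 : 0 < (1 - κ) * m := by positivity
    have h4 : (1 - κ) * m * ‖p 0‖ ≤ ‖f‖ := by
      by_cases h5 : ‖p 0‖ = 0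
      · rw [h5]; simp
      · have h6 : 0 < ‖p 0‖ := lt_of_le_of_ne (norm_nonneg _) (Ne.symm h5)
        nlinarith
    nlinarith [norm_nonneg f, norm_nonneg (p 0)]
  have hmain : (1 - κ) * m * ‖p ν‖ ^ 2 ≤
      ((2 * θ) ^ (∑ j, ν j)) ^ 2 * (‖f‖ ^ 2 / ((1 - κ) * m)) := by
    refine (h.mul_norm_sq_le hz (p ν)).trans ?_
    refine le_trans ?_ ((hiter (∑ j, ν j)).trans (mul_le_mul_of_nonneg_left hf0 (sq_nonneg _)))
    exact Finset.single_le_sum (f := fun ν => inner ℝ (a (p ν)) (p ν)) (fun ν _ => hnonneg _)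
      (Finset.mem_piAntidiag.2 ⟨rfl, by simp⟩)
  have hnorm : ‖p ν‖ ≤ (2 * θ) ^ (∑ j, ν j) * (‖f‖ / ((1 - κ) * m)) := by
    refine le_of_sq_le_sq ?_ (by positivity)
    have h3 : 0 < (1 - κ) * m := by positivity
    rw [← mul_le_mul_iff_right₀ h3]
    refine hmain.trans (le_of_eq ?_)
    field_simp
  have hsol : solDeriv A₀ A f ν z = scaleFactor b ν • p ν := by
    simp only [p]
    rw [smul_smul, mul_inv_cancel₀ (scaleFactor_pos h.b_pos ν).ne', one_smul]
  rw [hsol, norm_smul, Real.norm_of_nonneg (scaleFactor_pos h.b_pos ν).le, Finset.prod_mul_distrib,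
    Finset.prod_pow_eq_pow_sum]
  refine (mul_le_mul_of_nonneg_left hnorm (scaleFactor_pos h.b_pos ν).le).trans (le_of_eq ?_)
  unfold scaleFactor
  ring

end EnergyBound

/-! ### Mixed derivatives along a family -/

theorem partialDeriv_eqOn {ι : Type} [Fintype ι] [DecidableEq ι] {O : Set (ι → ℝ)} (hO : IsOpen O)
    {D : (ι → ℕ) → (ι → ℝ) → ℝ}
    (hd : ∀ ν, ∀ z ∈ O, ∀ j, HasDerivAt (fun t => D ν (Function.update z j t))
      (D (Function.update ν j (ν j + 1)) z) (z j))
    {H : (ι → ℝ) → ℝ} {ν : ι → ℕ} (hH : EqOn H (D ν) O) (j : ι) :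
    EqOn (partialDeriv j H) (D (Function.update ν j (ν j + 1))) O := by
  intro z hz
  have hev : (fun t => H (Function.update z j t)) =ᶠ[nhds (z j)]
      fun t => D ν (Function.update z j t) := by
    have hc : Filter.Tendsto (fun t => Function.update z j t) (nhds (z j)) (nhds z) := by
      have : Continuous fun t => Function.update z j t := by fun_prop
      simpa using this.tendsto (z j)
    filter_upwards [hc (hO.mem_nhds hz)] with t ht
    exact hH ht
  exact ((hd ν z hz j).congr_of_eventuallyEq hev).deriv

theorem partialDeriv_iterate_eqOn {ι : Type} [Fintype ι] [DecidableEq ι] {O : Set (ι → ℝ)}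
    (hO : IsOpen O) {D : (ι → ℕ) → (ι → ℝ) → ℝ}
    (hd : ∀ ν, ∀ z ∈ O, ∀ j, HasDerivAt (fun t => D ν (Function.update z j t))
      (D (Function.update ν j (ν j + 1)) z) (z j))
    {H : (ι → ℝ) → ℝ} {ν : ι → ℕ} (hH : EqOn H (D ν) O) (j : ι) (n : ℕ) :
    EqOn ((partialDeriv j)^[n] H) (D (Function.update ν j (ν j + n))) O := by
  induction n with
  | zero => simpa using hH
  | succ n ih =>
    rw [Function.iterate_succ_apply']
    have := partialDeriv_eqOn hO hd ih j
    simpa [add_assoc] using this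

/-- Induction along the list of variables: after those in `l` have been treated, the order is `ν` on
`l` and `0` elsewhere. Absence of repetitions ensures that a new variable still has order `0`.
Openness of `O` lets an identity on `O` be differentiated. -/
theorem mixedPartial_eqOn {ι : Type} [Fintype ι] [DecidableEq ι] {O : Set (ι → ℝ)} (hO : IsOpen O)
    {D : (ι → ℕ) → (ι → ℝ) → ℝ}
    (hd : ∀ ν, ∀ z ∈ O, ∀ j, HasDerivAt (fun t => D ν (Function.update z j t))
      (D (Function.update ν j (ν j + 1)) z) (z j))
    {F : (ι → ℝ) → ℝ} (hF : EqOn F (D 0) O) (ν : ι → ℕ) :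
    EqOn (mixedPartial ν F) (D ν) O := by
  have h : ∀ l : List ι, l.Nodup →
      EqOn (l.foldr (fun j H => (partialDeriv j)^[ν j] H) F)
        (D fun j => if j ∈ l then ν j else 0) O := by
    intro l
    induction l with
    | nil =>
      intro _
      have h0 : (fun j : ι => if j ∈ ([] : List ι) then ν j else 0) = 0 := by ext; simp
      rwa [h0]
    | cons a l ih =>
      intro hl
      rw [List.nodup_cons] at hl
      have h1 := partialDeriv_iterate_eqOn hO hd (ih hl.2) a (ν a)
      rw [List.foldr_cons]
      convert h1 using 2
      ext i
      by_cases hi : i = a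
      · subst hi
        simp [hl.1]
      · simp [hi]
  have := h Finset.univ.toList (Finset.nodup_toList _)
  simpa [mixedPartial] using this

/-! ### Bounding the Sobolev expression -/

/-- The cube has volume one and a null boundary. Only the open cube is usable: at a boundary point
an iterated derivative would depend on values outside the cube, which are not controlled. -/
theorem setIntegral_cube_sq_le {ι : Type*} [Fintype ι] (g : (ι → ℝ) → ℝ) {B : ℝ}
    (hB : ∀ t : ι → ℝ, (∀ j, t j ∈ Ioo (-(1 / 2) : ℝ) (1 / 2)) → |g t| ≤ B) :
    ∫ t in Set.univ.pi fun _ => Icc (-(1 / 2) : ℝ) (1 / 2), g t ^ 2 ≤ B ^ 2 := by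
  have h1 : (Set.univ.pi fun _ : ι => Ioo (-(1 / 2) : ℝ) (1 / 2)) =ᵐ[volume]
      Set.univ.pi fun _ : ι => Icc (-(1 / 2) : ℝ) (1 / 2) :=
    Measure.ae_eq_set_pi fun _ _ => Ioo_ae_eq_Icc
  have h2 : volume (Set.univ.pi fun _ : ι => Ioo (-(1 / 2) : ℝ) (1 / 2)) = 1 := by
    rw [volume_pi_pi]
    norm_num
  rw [← setIntegral_congr_set h1]
  have h3 := norm_setIntegral_le_of_norm_le_const (μ := volume)
    (s := Set.univ.pi fun _ : ι => Ioo (-(1 / 2) : ℝ) (1 / 2)) (f := fun t => g t ^ 2)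
    (C := B ^ 2) (by rw [h2]; exact ENNReal.one_lt_top) (fun t ht => by
      rw [Real.norm_eq_abs, abs_pow]
      exact pow_le_pow_left₀ (abs_nonneg _) (hB t fun j => ht j (mem_univ j)) 2)
  rw [Measure.real, h2] at h3
  simpa using (le_abs_self _).trans h3

theorem sobolevSq_le {ι : Type} [Fintype ι] [DecidableEq ι] {α : ℕ} (hα : 1 ≤ α)
    {D : (ι → ℕ) → (ι → ℝ) → ℝ}
    (hd : ∀ ν, ∀ z : ι → ℝ, (∀ i, z i ∈ Ioo (-(1 / 2) : ℝ) (1 / 2)) → ∀ j,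
      HasDerivAt (fun t => D ν (Function.update z j t))
      (D (Function.update ν j (ν j + 1)) z) (z j))
    {F : (ι → ℝ) → ℝ} (hF : ∀ z : ι → ℝ, (∀ i, z i ∈ Ioo (-(1 / 2) : ℝ) (1 / 2)) → F z = D 0 z)
    (M : ℝ) (c : ℕ → ℝ)
    (hbd : ∀ ν z, (∀ j, ν j ∈ Finset.Icc 1 α) → (∀ i, z i ∈ Ioo (-(1 / 2) : ℝ) (1 / 2)) →
      |D ν z| ≤ M * ∏ j, c (ν j)) :
    sobolevSq α F ≤ M ^ 2 * (∑ r ∈ Finset.Icc 1 α, c r ^ 2) ^ Fintype.card ι := by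
  have hO : IsOpen (Set.univ.pi fun _ : ι => Ioo (-(1 / 2) : ℝ) (1 / 2)) :=
    isOpen_set_pi finite_univ fun _ _ => isOpen_Ioo
  have hmp : ∀ ν, EqOn (mixedPartial ν F) (D ν)
      (Set.univ.pi fun _ : ι => Ioo (-(1 / 2) : ℝ) (1 / 2)) :=
    mixedPartial_eqOn hO (fun ν z hz j => hd ν z (fun i => hz i (mem_univ i)) j)
      fun z hz => hF z fun i => hz i (mem_univ i)
  have hsum : ∑ r ∈ Finset.Icc 1 α, c r ^ 2 =
      c α ^ 2 + ∑ r ∈ Finset.Icc 1 (α - 1), c r ^ 2 := by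
    obtain ⟨n, rfl⟩ : ∃ n, α = n + 1 := ⟨α - 1, by omega⟩
    rw [Finset.sum_Icc_succ_top (by omega), Nat.add_sub_cancel, add_comm]
  -- Expanding `∏_j (c α ^ 2 + ∑_{r<α} c r ^ 2)` over the set `v` of variables that choose order `α`
  -- reproduces the index set of the Sobolev expression.
  have htot : M ^ 2 * (∑ r ∈ Finset.Icc 1 α, c r ^ 2) ^ Fintype.card ι =
      ∑ v : Finset ι, ∑ ν ∈ Fintype.piFinset fun j => if j ∈ v then {α} else Finset.Icc 1 (α - 1),
        (M * ∏ j, c (ν j)) ^ 2 := by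
    rw [hsum, ← Finset.card_univ, ← Finset.prod_const, Finset.prod_add, Finset.mul_sum,
      Finset.powerset_univ]
    refine Finset.sum_congr rfl fun v _ => ?_
    simp only [mul_pow, ← Finset.mul_sum, ← Finset.prod_pow]
    congr 1
    rw [← Finset.prod_univ_sum (fun j => if j ∈ v then {α} else Finset.Icc 1 (α - 1))
      fun _ r => c r ^ 2, ← Finset.prod_sdiff (Finset.subset_univ v), mul_comm]
    congr 1
    · refine Finset.prod_congr rfl fun j hj => ?_
      rw [if_neg (Finset.mem_sdiff.1 hj).2]
    · refine Finset.prod_congr rfl fun j hj => ?_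
      rw [if_pos hj, Finset.sum_singleton]
  rw [htot]
  refine Finset.sum_le_sum fun v _ => Finset.sum_le_sum fun ν hν => ?_
  refine setIntegral_cube_sq_le _ fun t ht => ?_
  have hz : ∀ j, (if h : j ∈ v then t ⟨j, h⟩ else 0) ∈ Ioo (-(1 / 2) : ℝ) (1 / 2) := fun j => by
    split_ifs with h
    · exact ht _
    · norm_num
  rw [hmp ν fun j _ => hz j]
  refine hbd _ _ (fun j => ?_) hz
  have := Fintype.mem_piFinset.1 hν j
  split_ifs at this
  · simp only [Finset.mem_singleton] at this
    simp [this, hα]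
  · simp only [Finset.mem_Icc] at this ⊢
    omega

/-! ### The anchored family -/

/-- The point `z` with the coordinates outside `v` replaced by `0`. -/
def restrictTo {s : Finset ℕ} (v : Finset ℕ) (z : s → ℝ) : s → ℝ :=
  fun j => if (j : ℕ) ∈ v then z j else 0

/-- The mixed derivatives of the anchored term of a function with mixed derivatives `E ν`. -/
def anchoredFamily {s : Finset ℕ} (E : (s → ℕ) → (s → ℝ) → ℝ) (ν : s → ℕ) (z : s → ℝ) : ℝ :=
  ∑ v ∈ s.powerset, (-1 : ℝ) ^ (s.card - v.card) *
    if ∀ j : s, ν j ≠ 0 → (j : ℕ) ∈ v then E ν (restrictTo v z) else 0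

theorem restrictTo_mem {s v : Finset ℕ} {z : s → ℝ} (hz : ∀ j, z j ∈ Icc (-(1 / 2) : ℝ) (1 / 2))
    (j : s) : restrictTo v z j ∈ Icc (-(1 / 2) : ℝ) (1 / 2) := by
  unfold restrictTo
  split_ifs
  · exact hz j
  · norm_num

theorem continuous_restrictTo {s : Finset ℕ} (v : Finset ℕ) :
    Continuous (restrictTo v : (s → ℝ) → s → ℝ) := by
  refine continuous_pi fun j => ?_
  unfold restrictTo
  split_ifs
  · fun_prop
  · fun_prop

theorem contDiff_restrictTo {s : Finset ℕ} (v : Finset ℕ) {n : WithTop ℕ∞} :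
    ContDiff ℝ n (restrictTo v : (s → ℝ) → s → ℝ) := by
  refine contDiff_pi.2 fun j => ?_
  unfold restrictTo
  split_ifs
  · fun_prop
  · fun_prop

theorem restrictTo_update_of_mem {s v : Finset ℕ} {j : s} (hj : (j : ℕ) ∈ v) (z : s → ℝ) (t : ℝ) :
    restrictTo v (Function.update z j t) = Function.update (restrictTo v z) j t := by
  ext i
  by_cases hi : i = j
  · subst hi
    simp [restrictTo, hj]
  · simp [restrictTo, Function.update_of_ne hi]

theorem restrictTo_update_of_notMem {s v : Finset ℕ} {j : s} (hj : (j : ℕ) ∉ v) (z : s → ℝ)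
    (t : ℝ) : restrictTo v (Function.update z j t) = restrictTo v z := by
  ext i
  by_cases hi : i = j
  · subst hi
    simp [restrictTo, hj]
  · simp [restrictTo, Function.update_of_ne hi]

/-- A term whose `v` contains `j` is differentiated as `E` is; any other term is constant in `z j`,
and the support condition in the family deletes it. -/
theorem hasDerivAt_anchoredFamily {s : Finset ℕ} {E : (s → ℕ) → (s → ℝ) → ℝ}
    (hE : ∀ ν z j, (∀ i, z i ∈ Icc (-(1 / 2) : ℝ) (1 / 2)) →
      HasDerivAt (fun t => E ν (Function.update z j t)) (E (Function.update ν j (ν j + 1)) z) (z j))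
    (ν : s → ℕ) (z : s → ℝ) (j : s) (hz : ∀ i, z i ∈ Icc (-(1 / 2) : ℝ) (1 / 2)) :
    HasDerivAt (fun t => anchoredFamily E ν (Function.update z j t))
      (anchoredFamily E (Function.update ν j (ν j + 1)) z) (z j) := by
  unfold anchoredFamily
  refine HasDerivAt.fun_sum fun v _ => HasDerivAt.const_mul _ ?_
  by_cases hj : (j : ℕ) ∈ v
  · have hcond : (∀ i : s, Function.update ν j (ν j + 1) i ≠ 0 → (i : ℕ) ∈ v) ↔
        ∀ i : s, ν i ≠ 0 → (i : ℕ) ∈ v := by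
      refine forall_congr' fun i => ?_
      by_cases hi : i = j
      · subst hi
        simp [hj]
      · rw [Function.update_of_ne hi]
    simp only [hcond, restrictTo_update_of_mem hj]
    split_ifs
    · have h1 := hE ν (restrictTo v z) j (restrictTo_mem hz)
      rwa [show restrictTo v z j = z j by simp [restrictTo, hj]] at h1
    · exact hasDerivAt_const _ _
  · have hcond : ¬ ∀ i : s, Function.update ν j (ν j + 1) i ≠ 0 → (i : ℕ) ∈ v :=
      fun h => hj (h j (by simp))
    simp only [restrictTo_update_of_notMem hj, if_neg hcond]
    exact hasDerivAt_const _ _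

/-- The terms of `v` and of `v` with `j` added have equal values and opposite signs. This gives the
vanishing required by Taylor's formula at the anchor. -/
theorem anchoredFamily_eq_zero {s : Finset ℕ} (E : (s → ℕ) → (s → ℝ) → ℝ)
    {ν : s → ℕ} {z : s → ℝ} {j : s} (hν : ν j = 0) (hz : z j = 0) :
    anchoredFamily E ν z = 0 := by
  unfold anchoredFamily
  have hs : s = insert (j : ℕ) (s.erase j) := (Finset.insert_erase j.2).symm
  have hp : s.powerset = (insert (j : ℕ) (s.erase j)).powerset := congrArg _ hs
  rw [hp, Finset.sum_powerset_insert (Finset.notMem_erase _ _), ← Finset.sum_add_distrib]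
  refine Finset.sum_eq_zero fun v hv => ?_
  have hv' := Finset.mem_powerset.1 hv
  have hjv : (j : ℕ) ∉ v := fun h => Finset.notMem_erase _ _ (hv' h)
  have hcard : v.card + 1 ≤ s.card := by
    have := Finset.card_le_card hv'
    rw [Finset.card_erase_of_mem j.2] at this
    have := Finset.card_pos.2 ⟨_, j.2⟩
    omega
  have hcond : (∀ i : s, ν i ≠ 0 → (i : ℕ) ∈ insert (j : ℕ) v) ↔
      ∀ i : s, ν i ≠ 0 → (i : ℕ) ∈ v := by
    refine forall_congr' fun i => ?_
    by_cases hi : i = j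
    · subst hi
      simp [hν]
    · have : (i : ℕ) ≠ j := fun h => hi (Subtype.ext h)
      simp [this]
  have hres : restrictTo (insert (j : ℕ) v) z = restrictTo v z := by
    ext i
    by_cases hi : i = j
    · subst hi
      simp [restrictTo, hz]
    · have : (i : ℕ) ≠ j := fun h => hi (Subtype.ext h)
      simp [restrictTo, this]
  simp only [hcond, hres]
  rw [Finset.card_insert_of_notMem hjv,
    show s.card - v.card = (s.card - (v.card + 1)) + 1 by omega, pow_succ]
  ring

/-- Only `v = s` contains every differentiated variable, so the anchoring corrections disappear. -/
theorem anchoredFamily_of_forall_ne_zero {s : Finset ℕ} (E : (s → ℕ) → (s → ℝ) → ℝ)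
    {ν : s → ℕ} (hν : ∀ j, ν j ≠ 0) (z : s → ℝ) : anchoredFamily E ν z = E ν z := by
  unfold anchoredFamily
  rw [Finset.sum_eq_single s]
  · have hres : restrictTo s z = z := by
      ext i
      simp [restrictTo]
    simp [hres]
  · intro v hv hvs
    rw [if_neg, mul_zero]
    intro h
    exact hvs (Finset.Subset.antisymm (Finset.mem_powerset.1 hv) fun j hj => h ⟨j, hj⟩ (hν _))
  · simp

theorem continuousAt_anchoredFamily {s : Finset ℕ} {E : (s → ℕ) → (s → ℝ) → ℝ} {ν : s → ℕ}
    (hE : ∀ z, (∀ i, z i ∈ Icc (-(1 / 2) : ℝ) (1 / 2)) → ContinuousAt (E ν) z) {z : s → ℝ}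
    (hz : ∀ i, z i ∈ Icc (-(1 / 2) : ℝ) (1 / 2)) : ContinuousAt (anchoredFamily E ν) z := by
  unfold anchoredFamily
  refine tendsto_finsetSum _ fun v _ => ?_
  refine Filter.Tendsto.const_mul _ ?_
  split_ifs
  · exact ContinuousAt.comp (g := E ν) (hE _ (restrictTo_mem hz))
      (continuous_restrictTo v).continuousAt
  · exact tendsto_const_nhds

/-! ### From derivative bounds to anchored terms -/

/-- The projection onto the cube. -/
def clampCube {ι : Type*} (z : ι → ℝ) : ι → ℝ := fun j => max (-(1 / 2)) (min (1 / 2) (z j))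

theorem clampCube_mem {ι : Type*} (z : ι → ℝ) (j : ι) :
    clampCube z j ∈ Icc (-(1 / 2) : ℝ) (1 / 2) :=
  ⟨le_max_left _ _, max_le (by norm_num) (min_le_left _ _)⟩

theorem clampCube_of_mem {ι : Type*} {z : ι → ℝ} (hz : ∀ j, z j ∈ Icc (-(1 / 2) : ℝ) (1 / 2)) :
    clampCube z = z := by
  ext j
  simp only [clampCube]
  rw [min_eq_right (hz j).2, max_eq_right (hz j).1]

theorem continuous_clampCube {ι : Type*} : Continuous (clampCube : (ι → ℝ) → ι → ℝ) := by
  unfold clampCube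
  fun_prop

/-- Membership in the anchored space and the two bounds for the anchored term, from bounds for the
mixed derivatives `E ν`. -/
theorem exists_anchoredRKHS_of_family {α : ℕ} (hα : 1 ≤ α) (s : Finset ℕ)
    {E : (s → ℕ) → (s → ℝ) → ℝ}
    (hE : ∀ ν z j, (∀ i, z i ∈ Icc (-(1 / 2) : ℝ) (1 / 2)) →
      HasDerivAt (fun t => E ν (Function.update z j t)) (E (Function.update ν j (ν j + 1)) z) (z j))
    (hEc : ∀ ν z, (∀ i, z i ∈ Icc (-(1 / 2) : ℝ) (1 / 2)) → ContinuousAt (E ν) z)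
    (M : ℝ) (hM : 0 ≤ M) (c : ℕ → ℝ)
    (hbd : ∀ ν z, (∀ j, ν j ∈ Finset.Icc 1 α) → (∀ i, z i ∈ Icc (-(1 / 2) : ℝ) (1 / 2)) →
      |E ν z| ≤ M * ∏ j, c (ν j)) :
    ∃ F : AnchoredRKHS α s, (∀ z : Cube s, F z = anchoredFamily E 0 fun j => (z j : ℝ)) ∧
      ‖F‖ ≤ M * √((∑ r ∈ Finset.Icc 1 α, c r ^ 2) ^ s.card) := by
  have hb : ∀ ν z, (∀ j, ν j ∈ Finset.Icc 1 α) → (∀ i, z i ∈ Icc (-(1 / 2) : ℝ) (1 / 2)) →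
      |anchoredFamily E ν z| ≤ M * ∏ j, c (ν j) := fun ν z hν hz => by
    rw [anchoredFamily_of_forall_ne_zero E fun j => by
      have := Finset.mem_Icc.1 (hν j)
      omega]
    exact hbd ν z hν hz
  obtain ⟨F, hF, hFn⟩ := exists_anchoredRKHS hα s
    -- The family is controlled only on the cube, while continuity is required everywhere; clamping
    -- extends it. Differentiability is lost at most at the endpoints, where it is not asked for.
    (fun ν z => anchoredFamily E ν (clampCube z))
    (fun ν => continuous_iff_continuousAt.2 fun z => ContinuousAt.comp (g := anchoredFamily E ν)
      (continuousAt_anchoredFamily (hEc ν) (clampCube_mem z)) continuous_clampCube.continuousAt)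
    (fun ν z j hz hj => by
      rw [clampCube_of_mem hz]
      refine (hasDerivAt_anchoredFamily hE ν z j hz).congr_of_eventuallyEq ?_
      filter_upwards [Ioo_mem_nhds hj.1 hj.2] with t ht
      rw [clampCube_of_mem]
      intro i
      by_cases hi : i = j
      · subst hi
        simpa using Ioo_subset_Icc_self ht
      · rw [Function.update_of_ne hi]
        exact hz i)
    (fun ν z j hz hν hj => by
      rw [clampCube_of_mem hz]
      exact anchoredFamily_eq_zero E hν hj) M hM c
    (fun ν z hν hz => hb ν _ hν (clampCube_mem z))
  refine ⟨F, fun z => ?_, hFn⟩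
  rw [hF, clampCube_of_mem fun j => (z j).2]

theorem sobolevSq_anchored_le {α : ℕ} (hα : 1 ≤ α) (s : Finset ℕ)
    {E : (s → ℕ) → (s → ℝ) → ℝ}
    (hE : ∀ ν z j, (∀ i, z i ∈ Icc (-(1 / 2) : ℝ) (1 / 2)) →
      HasDerivAt (fun t => E ν (Function.update z j t)) (E (Function.update ν j (ν j + 1)) z) (z j))
    (M : ℝ) (c : ℕ → ℝ)
    (hbd : ∀ ν z, (∀ j, ν j ∈ Finset.Icc 1 α) → (∀ i, z i ∈ Icc (-(1 / 2) : ℝ) (1 / 2)) →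
      |E ν z| ≤ M * ∏ j, c (ν j))
    {F : (s → ℝ) → ℝ} (hF : ∀ z : s → ℝ, (∀ i, z i ∈ Icc (-(1 / 2) : ℝ) (1 / 2)) →
      F z = anchoredFamily E 0 z) :
    sobolevSq α F ≤ M ^ 2 * (∑ r ∈ Finset.Icc 1 α, c r ^ 2) ^ s.card := by
  have h := sobolevSq_le hα (D := anchoredFamily E)
    (fun ν z hz j => hasDerivAt_anchoredFamily hE ν z j fun i => Ioo_subset_Icc_self (hz i))
    (fun z hz => hF z fun i => Ioo_subset_Icc_self (hz i)) M c
    (fun ν z hν hz => by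
      rw [anchoredFamily_of_forall_ne_zero E fun j => by
        have := Finset.mem_Icc.1 (hν j)
        omega]
      exact hbd ν z hν fun i => Ioo_subset_Icc_self (hz i))
  simpa using h

/-! ### The constant -/

/-- Apart from the factor `1`, `r!` has `r - 1` factors, each at most `r ≤ α`. Hence `r! ≤ α ^ (r -
1)`, which leaves `ρ ^ (r - 1) * (ρ / α)`. -/
theorem factorial_mul_pow_le {α r : ℕ} (hr : r ∈ Finset.Icc 1 α) {ρ : ℝ} (hρ0 : 0 ≤ ρ)
    (hρ1 : ρ ≤ 1) : (r.factorial : ℝ) * (ρ / α) ^ r ≤ ρ / α := by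
  rw [Finset.mem_Icc] at hr
  have hα : (0 : ℝ) < α := by exact_mod_cast (by omega : 0 < α)
  obtain ⟨n, rfl⟩ : ∃ n, r = n + 1 := ⟨r - 1, by omega⟩
  have h1 : ((n + 1).factorial : ℝ) ≤ (α : ℝ) ^ n := by
    have h2 : (n + 1).factorial ≤ (n + 1) ^ n := by
      have h3 := Nat.descFactorial_le_pow (n + 1) n
      rwa [← Nat.descFactorial_self, Nat.descFactorial_succ, Nat.add_sub_cancel_left, one_mul]
    exact_mod_cast h2.trans (Nat.pow_le_pow_left hr.2 n)
  calc ((n + 1).factorial : ℝ) * (ρ / α) ^ (n + 1)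
      ≤ (α : ℝ) ^ n * (ρ / α) ^ (n + 1) := mul_le_mul_of_nonneg_right h1 (by positivity)
    _ = ρ ^ n * (ρ / α) := by rw [pow_succ, ← mul_assoc, ← mul_pow, mul_div_cancel₀ _ hα.ne']
    _ ≤ ρ / α := mul_le_of_le_one_left (by positivity) (pow_le_one₀ hρ0 hρ1)

/-- Each of the `α` summands is at most `(ρ / α)²`, so the sum is at most `ρ² < 1`. A positive power
stays below `ρ²`, the `k = 0` term of the series; the exponent `0` would give `1`, hence the
restriction to nonempty sets. -/
theorem sum_sq_pow_le_normConst {α : ℕ} (hα : 1 ≤ α) {κ : ℝ} (hκ0 : 0 < κ)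
    (hκα : κ < 1 / (2 * α + 1)) {n : ℕ} (hn : n ≠ 0) :
    (∑ r ∈ Finset.Icc 1 α, ((r.factorial : ℝ) * (2 * (κ / (1 - κ))) ^ r) ^ 2) ^ n ≤
      normConst κ α := by
  have hα0 : (1 : ℝ) ≤ α := by exact_mod_cast hα
  rw [lt_div_iff₀ (by positivity)] at hκα
  have hκ1 : 0 < 1 - κ := by nlinarith
  set ρ : ℝ := 2 * α * κ / (1 - κ) with hρ
  have hρ0 : 0 < ρ := by positivity
  have hρ1 : ρ < 1 := by
    rw [hρ, div_lt_one hκ1]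
    linarith
  have hθ : 2 * (κ / (1 - κ)) = ρ / α := by
    rw [hρ]
    field_simp
  have h1 : ∑ r ∈ Finset.Icc 1 α, ((r.factorial : ℝ) * (2 * (κ / (1 - κ))) ^ r) ^ 2 ≤ ρ ^ 2 := by
    rw [hθ]
    calc ∑ r ∈ Finset.Icc 1 α, ((r.factorial : ℝ) * (ρ / α) ^ r) ^ 2
        ≤ ∑ r ∈ Finset.Icc 1 α, (ρ / α) ^ 2 := Finset.sum_le_sum fun r hr =>
          pow_le_pow_left₀ (by positivity) (factorial_mul_pow_le hr hρ0.le hρ1.le) 2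
      _ = ρ ^ 2 / α := by
          rw [Finset.sum_const, Nat.card_Icc, nsmul_eq_mul]
          simp only [Nat.add_sub_cancel]
          field_simp
      _ ≤ ρ ^ 2 := div_le_self (sq_nonneg _) hα0
  have h2 : (0 : ℝ) ≤ ∑ r ∈ Finset.Icc 1 α, ((r.factorial : ℝ) * (2 * (κ / (1 - κ))) ^ r) ^ 2 :=
    Finset.sum_nonneg fun _ _ => sq_nonneg _
  have hρ2 : ρ ^ 2 < 1 := by nlinarith
  have hsumm : Summable fun k : ℕ => ρ ^ (2 * (k + 1)) := by
    have : (fun k : ℕ => ρ ^ (2 * (k + 1))) = fun k : ℕ => ρ ^ 2 * (ρ ^ 2) ^ k := by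
      funext k
      rw [pow_mul, pow_succ']
    rw [this]
    exact (summable_geometric_of_lt_one (sq_nonneg _) hρ2).mul_left _
  calc _ ≤ (ρ ^ 2) ^ n := pow_le_pow_left₀ h2 h1 n
    _ ≤ ρ ^ 2 := pow_le_of_le_one (sq_nonneg _) hρ2.le hn
    _ = ρ ^ (2 * (0 + 1)) := by norm_num
    _ ≤ normConst κ α := hsumm.le_tsum 0 fun k _ => by positivity

/-! ### Poincaré's inequality -/

theorem norm_gradient {E : Type*} [NormedAddCommGroup E] [InnerProductSpace ℝ E] [CompleteSpace E]
    (f : E → ℝ) (x : E) : ‖gradient f x‖ = ‖fderiv ℝ f x‖ := by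
  simp [gradient]

section Poincare

variable {d : ℕ} {D : TopologicalSpace.Opens (EuclideanSpace ℝ (Fin d))}

/-- Integrate `ψ²` by parts against a coordinate function `ℓ`, whose derivative in its own direction
is `1` and which is bounded by `R` on `D`; then absorb half of `∫ ψ²` by Young's inequality. -/
theorem integral_sq_le_integral_gradient_sq (hd : 0 < d) {R : ℝ}
    (hDR : ∀ x ∈ D, ‖x‖ ≤ R) (ψ : 𝓓(D, ℝ)) :
    ∫ x, ψ x ^ 2 ≤ 4 * R ^ 2 * ∫ x, ‖gradient ψ x‖ ^ 2 := by
  let i : Fin d := ⟨0, hd⟩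
  let v : EuclideanSpace ℝ (Fin d) := EuclideanSpace.single i 1
  let ℓ : EuclideanSpace ℝ (Fin d) →L[ℝ] ℝ := EuclideanSpace.proj i
  have hψ : ContDiff ℝ ∞ (ψ : EuclideanSpace ℝ (Fin d) → ℝ) := by simpa using! ψ.contDiff
  have hdiff : Differentiable ℝ (ψ : EuclideanSpace ℝ (Fin d) → ℝ) := hψ.differentiable (by simp)
  have hcs : HasCompactSupport (ψ : EuclideanSpace ℝ (Fin d) → ℝ) := ψ.hasCompactSupport
  have hfc : Continuous (fderiv ℝ (ψ : EuclideanSpace ℝ (Fin d) → ℝ)) :=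
    hψ.continuous_fderiv (by simp)
  have hψc := ψ.continuous
  have hsupp : ∀ x, x ∉ D → ψ x = 0 := fun x hx => by
    by_contra h
    exact hx (ψ.tsupport_subset (subset_tsupport _ h))
  have hfd : ∀ x, fderiv ℝ (fun x => ψ x ^ 2) x v = 2 * ψ x * fderiv ℝ ψ x v := fun x => by
    rw [((hdiff x).hasFDerivAt.pow 2).fderiv]
    simp
  have hℓv : ℓ v = 1 := by simp [ℓ, v]
  have hv : ‖v‖ = 1 := by simp [v]
  have hint : ∀ g : EuclideanSpace ℝ (Fin d) → ℝ, Continuous g →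
      Integrable (fun x => ψ x * g x) volume := fun g hg =>
    (hψc.mul hg).integrable_of_hasCompactSupport hcs.mul_right
  have hsq : Integrable (fun x => ψ x ^ 2) volume := by
    simpa [sq] using hint ψ hψc
  have hparts := integral_mul_fderiv_eq_neg_fderiv_mul_of_integrable (𝕜 := ℝ)
    (μ := (volume : Measure (EuclideanSpace ℝ (Fin d)))) (f := fun x => ψ x ^ 2) (g := ℓ) (v := v)
    (by
      simp only [hfd]
      refine (hint (fun x => 2 * fderiv ℝ ψ x v * ℓ x) (by fun_prop)).congr ?_
      exact Filter.Eventually.of_forall fun x => by ring)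
    (by simpa [hℓv] using hsq)
    ((hint (fun x => ψ x * ℓ x) (by fun_prop)).congr
      (Filter.Eventually.of_forall fun x => by ring))
    (fun x _ => (hdiff x).pow 2) (fun x _ => ℓ.differentiableAt)
  simp only [ContinuousLinearMap.fderiv, hℓv, mul_one, hfd] at hparts
  have hgrad : Integrable (fun x => ‖gradient ψ x‖ ^ 2) volume := by
    simp only [norm_gradient]
    refine Continuous.integrable_of_hasCompactSupport (by fun_prop) ?_
    exact (hcs.fderiv ℝ).comp_left (g := fun L => ‖L‖ ^ 2) (by simp)
  have hbound : ∀ x, -(2 * ψ x * fderiv ℝ ψ x v * ℓ x) ≤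
      1 / 2 * ψ x ^ 2 + 2 * R ^ 2 * ‖gradient ψ x‖ ^ 2 := by
    intro x
    by_cases hx : x ∈ D
    · have h1 : |fderiv ℝ ψ x v| ≤ ‖gradient ψ x‖ := by
        rw [norm_gradient]
        simpa [hv] using (fderiv ℝ ψ x).le_opNorm v
      have h2 : |ℓ x| ≤ R := (by simpa [ℓ] using PiLp.norm_apply_le x i : |ℓ x| ≤ ‖x‖).trans
        (hDR x hx)
      have h3 : |fderiv ℝ ψ x v * ℓ x| ≤ ‖gradient ψ x‖ * R := by
        rw [abs_mul]
        exact mul_le_mul h1 h2 (abs_nonneg _) (norm_nonneg _)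
      have h4 : (fderiv ℝ ψ x v * ℓ x) ^ 2 ≤ (‖gradient ψ x‖ * R) ^ 2 := by
        rw [← sq_abs]
        exact pow_le_pow_left₀ (abs_nonneg _) h3 2
      nlinarith [sq_nonneg (ψ x + 2 * (fderiv ℝ ψ x v * ℓ x))]
    · rw [hsupp x hx]
      simp only [mul_zero, zero_mul, neg_zero]
      positivity
  have hle : ∫ x, ψ x ^ 2 ≤ ∫ x, (1 / 2 * ψ x ^ 2 + 2 * R ^ 2 * ‖gradient ψ x‖ ^ 2) := by
    rw [hparts, ← integral_neg]
    refine integral_mono ?_ ((hsq.const_mul _).add (hgrad.const_mul _)) hbound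
    refine ((hint (fun x => 2 * fderiv ℝ ψ x v * ℓ x) (by fun_prop)).congr ?_).neg
    exact Filter.Eventually.of_forall fun x => by ring
  rw [integral_add (hsq.const_mul _) (hgrad.const_mul _), integral_const_mul,
    integral_const_mul] at hle
  linarith

theorem norm_sq_eq_setIntegral {F : Type} [NormedAddCommGroup F] [InnerProductSpace ℝ F]
    (p : L2 D F) : ‖p‖ ^ 2 = ∫ x in (D : Set (EuclideanSpace ℝ (Fin d))), ‖p x‖ ^ 2 := by
  rw [← real_inner_self_eq_norm_sq, L2.inner_def]
  simp only [real_inner_self_eq_norm_sq]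

/-- The generating pairs already form a subspace, so the span adds nothing and Poincaré's inequality
need only be checked for single test functions before closing up. -/
theorem exists_testFunction_of_mem_span {p : L2 D ℝ × L2 D (EuclideanSpace ℝ (Fin d))}
    (hp : p ∈ Submodule.span ℝ {p : L2 D ℝ × L2 D (EuclideanSpace ℝ (Fin d)) | ∃ ψ : 𝓓(D, ℝ),
      p.1 =ᵐ[volume.restrict (D : Set (EuclideanSpace ℝ (Fin d)))] (fun x => ψ x) ∧
      p.2 =ᵐ[volume.restrict (D : Set (EuclideanSpace ℝ (Fin d)))] (fun x => gradient ψ x)}) :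
    ∃ ψ : 𝓓(D, ℝ),
      p.1 =ᵐ[volume.restrict (D : Set (EuclideanSpace ℝ (Fin d)))] (fun x => ψ x) ∧
      p.2 =ᵐ[volume.restrict (D : Set (EuclideanSpace ℝ (Fin d)))] (fun x => gradient ψ x) := by
  have hdiff : ∀ ψ : 𝓓(D, ℝ), Differentiable ℝ (ψ : EuclideanSpace ℝ (Fin d) → ℝ) := fun ψ => by
    have hψ : ContDiff ℝ ∞ (ψ : EuclideanSpace ℝ (Fin d) → ℝ) := by simpa using! ψ.contDiff
    exact hψ.differentiable (by simp)
  induction hp using Submodule.span_induction with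
  | mem p hp => exact hp
  | zero =>
    refine ⟨0, ?_, ?_⟩
    · filter_upwards [Lp.coeFn_zero ℝ 2 (volume.restrict (D : Set (EuclideanSpace ℝ (Fin d))))]
        with x hx
      simpa using hx
    · filter_upwards [Lp.coeFn_zero (EuclideanSpace ℝ (Fin d)) 2
        (volume.restrict (D : Set (EuclideanSpace ℝ (Fin d))))] with x hx
      have h0 : ((0 : 𝓓(D, ℝ)) : EuclideanSpace ℝ (Fin d) → ℝ) = fun _ => 0 := by ext; simp
      rw [h0]
      simpa [gradient] using hx
  | add p q _ _ hp hq =>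
    obtain ⟨ψ, h1, h2⟩ := hp
    obtain ⟨χ, h3, h4⟩ := hq
    refine ⟨ψ + χ, ?_, ?_⟩
    · filter_upwards [h1, h3, Lp.coeFn_add p.1 q.1] with x e1 e3 e
      rw [Prod.fst_add, e]
      simp [e1, e3]
    · filter_upwards [h2, h4, Lp.coeFn_add p.2 q.2] with x e1 e3 e
      have h0 : ((ψ + χ : 𝓓(D, ℝ)) : EuclideanSpace ℝ (Fin d) → ℝ) = fun x => ψ x + χ x := by
        ext; simp
      rw [Prod.snd_add, e, Pi.add_apply, e1, e3, h0]
      simp only [gradient]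
      rw [fderiv_fun_add (hdiff ψ x) (hdiff χ x), map_add]
  | smul c p _ hp =>
    obtain ⟨ψ, h1, h2⟩ := hp
    refine ⟨c • ψ, ?_, ?_⟩
    · filter_upwards [h1, Lp.coeFn_smul c p.1] with x e1 e
      rw [Prod.smul_fst, e]
      simp [e1]
    · filter_upwards [h2, Lp.coeFn_smul c p.2] with x e1 e
      have h0 : ((c • ψ : 𝓓(D, ℝ)) : EuclideanSpace ℝ (Fin d) → ℝ) = fun x => c • ψ x := by
        ext; simp
      rw [Prod.smul_snd, e, Pi.smul_apply, e1, h0]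
      simp only [gradient]
      rw [fderiv_fun_const_smul (hdiff ψ x), map_smul]

theorem exists_poincare (hd : 0 < d)
    (hD : Bornology.IsBounded (D : Set (EuclideanSpace ℝ (Fin d)))) :
    ∃ C : ℝ, 0 ≤ C ∧ ∀ p ∈ h10Submodule D, ‖p.1‖ ≤ C * ‖p.2‖ := by
  obtain ⟨R, hR0, hR⟩ := hD.exists_pos_norm_le
  refine ⟨2 * R, by positivity, fun p hp => ?_⟩
  have hcl : IsClosed {p : L2 D ℝ × L2 D (EuclideanSpace ℝ (Fin d)) | ‖p.1‖ ≤ 2 * R * ‖p.2‖} :=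
    isClosed_le (by fun_prop) (by fun_prop)
  refine closure_minimal (fun p hp => ?_) hcl hp
  obtain ⟨ψ, h1, h2⟩ := exists_testFunction_of_mem_span hp
  have hsupp : ∀ x, x ∉ (D : Set (EuclideanSpace ℝ (Fin d))) → x ∉ tsupport ψ :=
    fun x hx h => hx (ψ.tsupport_subset h)
  have e1 : ‖p.1‖ ^ 2 = ∫ x, ψ x ^ 2 := by
    rw [norm_sq_eq_setIntegral, ← setIntegral_eq_integral_of_forall_compl_eq_zero
      (s := (D : Set (EuclideanSpace ℝ (Fin d)))) (f := fun x => ψ x ^ 2) fun x hx => by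
        rw [image_eq_zero_of_notMem_tsupport (hsupp x hx)]; simp]
    refine integral_congr_ae ?_
    filter_upwards [h1] with x hx
    rw [hx, Real.norm_eq_abs, sq_abs]
  have e2 : ‖p.2‖ ^ 2 = ∫ x, ‖gradient ψ x‖ ^ 2 := by
    rw [norm_sq_eq_setIntegral, ← setIntegral_eq_integral_of_forall_compl_eq_zero
      (s := (D : Set (EuclideanSpace ℝ (Fin d)))) (f := fun x => ‖gradient ψ x‖ ^ 2) fun x hx => by
        rw [norm_gradient, image_eq_zero_of_notMem_tsupport
          (fun h => hsupp x hx (tsupport_fderiv_subset ℝ h))]; simp]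
    refine integral_congr_ae ?_
    filter_upwards [h2] with x hx
    rw [hx]
  have h3 := integral_sq_le_integral_gradient_sq hd hR ψ
  rw [← e1, ← e2] at h3
  show ‖p.1‖ ≤ 2 * R * ‖p.2‖
  refine le_of_sq_le_sq ?_ (by positivity)
  refine h3.trans (le_of_eq ?_)
  ring

theorem grad_injective (hd : 0 < d)
    (hD : Bornology.IsBounded (D : Set (EuclideanSpace ℝ (Fin d)))) :
    Function.Injective (grad D) := by
  obtain ⟨C, -, hC⟩ := exists_poincare hd hD
  rw [injective_iff_map_eq_zero]
  intro w hw
  let w' : h10Submodule D := w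
  have h2 : (w' : L2 D ℝ × L2 D (EuclideanSpace ℝ (Fin d))).2 = 0 := hw
  have h1 := hC w' w'.2
  rw [h2, norm_zero, mul_zero] at h1
  have h3 : (w' : L2 D ℝ × L2 D (EuclideanSpace ℝ (Fin d))).1 = 0 := norm_le_zero_iff.1 h1
  have h4 : w' = 0 := Subtype.ext (Prod.ext h3 h2)
  exact h4

/-- By Poincaré's inequality the gradient is bounded below on the complete space of pairs. Its range
is therefore a Hilbert space, which stands in for `V` from here on. -/
theorem isClosed_range_grad (hd : 0 < d)
    (hD : Bornology.IsBounded (D : Set (EuclideanSpace ℝ (Fin d)))) :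
    IsClosed (LinearMap.range (grad D) : Set (L2 D (EuclideanSpace ℝ (Fin d)))) := by
  obtain ⟨C, hC0, hC⟩ := exists_poincare hd hD
  let T : h10Submodule D →L[ℝ] L2 D (EuclideanSpace ℝ (Fin d)) :=
    (ContinuousLinearMap.snd ℝ (L2 D ℝ) (L2 D (EuclideanSpace ℝ (Fin d)))).comp
      (h10Submodule D).subtypeL
  have hcomp : CompleteSpace (h10Submodule D) :=
    (Submodule.isClosed_topologicalClosure _).completeSpace_coe
  have hT : AntilipschitzWith (Real.toNNReal (C + 1)) T := by
    refine AddMonoidHomClass.antilipschitz_of_bound T fun w => ?_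
    rw [Real.coe_toNNReal _ (by positivity)]
    have h1 := hC w w.2
    have h2 : ‖w‖ = max ‖(w : L2 D ℝ × L2 D (EuclideanSpace ℝ (Fin d))).1‖
      ‖(w : L2 D ℝ × L2 D (EuclideanSpace ℝ (Fin d))).2‖ := rfl
    have h3 : ‖T w‖ = ‖(w : L2 D ℝ × L2 D (EuclideanSpace ℝ (Fin d))).2‖ := rfl
    rw [h2, h3]
    have h4 := norm_nonneg (w : L2 D ℝ × L2 D (EuclideanSpace ℝ (Fin d))).2
    refine max_le (by linarith) (by nlinarith)
  have h := hT.isClosed_range T.uniformContinuous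
  exact h

end Poincare

/-! ### Operators of weighted inner products -/

section FormOp

variable {X F : Type*} [MeasurableSpace X] {μ : Measure X} [NormedAddCommGroup F]
  [InnerProductSpace ℝ F]

/-- Multiplication of `L²` functions by an essentially bounded function. -/
def multOp {ϕ : X → ℝ} (hϕ : MemLp ϕ ⊤ μ) : Lp F 2 μ →L[ℝ] Lp F 2 μ :=
  (ContinuousLinearMap.lsmul ℝ ℝ : ℝ →L[ℝ] F →L[ℝ] F).holderL μ ⊤ 2 2 (hϕ.toLp ϕ)

theorem coeFn_multOp {ϕ : X → ℝ} (hϕ : MemLp ϕ ⊤ μ) (p : Lp F 2 μ) :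
    multOp hϕ p =ᵐ[μ] fun x => ϕ x • p x := by
  have h := (ContinuousLinearMap.lsmul ℝ ℝ : ℝ →L[ℝ] F →L[ℝ] F).coeFn_holder (r := 2)
    (hϕ.toLp ϕ) p
  filter_upwards [h, hϕ.coeFn_toLp] with x h1 h2
  rw [multOp, ContinuousLinearMap.holderL_apply_apply, h1, h2]
  rfl

theorem integrable_mul_inner {ϕ : X → ℝ} (hϕ : MemLp ϕ ⊤ μ) (p q : Lp F 2 μ) :
    Integrable (fun x => ϕ x * inner ℝ (p x) (q x)) μ := by
  refine (L2.integrable_inner (𝕜 := ℝ) (multOp hϕ p) q).congr ?_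
  filter_upwards [coeFn_multOp hϕ p] with x hx
  rw [hx, real_inner_smul_left]

variable [CompleteSpace F]

/-- The operator on a closed subspace `W` of `L²` representing the form `(p, q) ↦ ∫ ϕ ⟪p, q⟫`. -/
def formOp (W : Submodule ℝ (Lp F 2 μ)) [CompleteSpace W] {ϕ : X → ℝ} (hϕ : MemLp ϕ ⊤ μ) :
    W →L[ℝ] W :=
  (ContinuousLinearMap.adjoint W.subtypeL).comp ((multOp hϕ).comp W.subtypeL)

theorem inner_formOp (W : Submodule ℝ (Lp F 2 μ)) [CompleteSpace W] {ϕ : X → ℝ}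
    (hϕ : MemLp ϕ ⊤ μ) (p q : W) :
    inner ℝ (formOp W hϕ p) q =
      ∫ x, ϕ x * inner ℝ ((p : Lp F 2 μ) x) ((q : Lp F 2 μ) x) ∂μ := by
  simp only [formOp, ContinuousLinearMap.comp_apply, ContinuousLinearMap.adjoint_inner_left]
  rw [L2.inner_def]
  refine integral_congr_ae ?_
  filter_upwards [coeFn_multOp hϕ (p : Lp F 2 μ)] with x hx
  simp only [Submodule.subtypeL_apply]
  rw [hx, real_inner_smul_left]

theorem mul_norm_sq_le_inner_formOp (W : Submodule ℝ (Lp F 2 μ)) [CompleteSpace W] {ϕ : X → ℝ}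
    (hϕ : MemLp ϕ ⊤ μ) {c : ℝ} (hc : ∀ᵐ x ∂μ, c ≤ ϕ x) (p : W) :
    c * ‖p‖ ^ 2 ≤ inner ℝ (formOp W hϕ p) p := by
  rw [inner_formOp, Submodule.coe_norm, ← real_inner_self_eq_norm_sq, L2.inner_def,
    ← integral_const_mul]
  refine integral_mono_ae ((L2.integrable_inner _ _).const_mul _) (integrable_mul_inner hϕ _ _) ?_
  filter_upwards [hc] with x hx
  exact mul_le_mul_of_nonneg_right hx real_inner_self_nonneg

theorem abs_inner_formOp_le (W : Submodule ℝ (Lp F 2 μ)) [CompleteSpace W] {ϕ : X → ℝ}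
    (hϕ : MemLp ϕ ⊤ μ) (p q : W) {t : ℝ} (ht : 0 < t) :
    |inner ℝ (formOp W hϕ p) q| ≤
      (t * ∫ x, |ϕ x| * inner ℝ ((p : Lp F 2 μ) x) ((p : Lp F 2 μ) x) ∂μ +
        (∫ x, |ϕ x| * inner ℝ ((q : Lp F 2 μ) x) ((q : Lp F 2 μ) x) ∂μ) / t) / 2 := by
  rw [inner_formOp]
  have hp := integrable_mul_inner hϕ.abs (p : Lp F 2 μ) p
  have hq := integrable_mul_inner hϕ.abs (q : Lp F 2 μ) q
  simp only [Pi.abs_apply] at hp hq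
  rw [← integral_const_mul, ← integral_div, ← integral_add (hp.const_mul t) (hq.div_const t),
    ← integral_div]
  refine abs_integral_le_integral_abs.trans ?_
  refine integral_mono (integrable_mul_inner hϕ _ _).abs
    (((hp.const_mul t).add (hq.div_const t)).div_const 2) fun x => ?_
  set v := (p : Lp F 2 μ) x
  set w := (q : Lp F 2 μ) x
  simp only [abs_mul, real_inner_self_eq_norm_sq]
  have h1 : |inner ℝ v w| ≤ (t * ‖v‖ ^ 2 + ‖w‖ ^ 2 / t) / 2 := by
    refine (abs_real_inner_le_norm v w).trans ?_
    have h2 : (t * ‖v‖ ^ 2 + ‖w‖ ^ 2 / t) / 2 - ‖v‖ * ‖w‖ = (t * ‖v‖ - ‖w‖) ^ 2 / (2 * t) := by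
      field_simp
      ring
    have h3 : 0 ≤ (t * ‖v‖ - ‖w‖) ^ 2 / (2 * t) := by positivity
    linarith
  calc |ϕ x| * |inner ℝ v w| ≤ |ϕ x| * ((t * ‖v‖ ^ 2 + ‖w‖ ^ 2 / t) / 2) :=
        mul_le_mul_of_nonneg_left h1 (abs_nonneg _)
    _ = _ := by ring

/-- The energy bounds for finitely many weights. -/
theorem energyBound_formOp {ι : Type*} [Fintype ι] (W : Submodule ℝ (Lp F 2 μ)) [CompleteSpace W]
    {a₀ : X → ℝ} (ha₀ : MemLp a₀ ⊤ μ) {φ : ι → X → ℝ} (hφ : ∀ j, MemLp (φ j) ⊤ μ)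
    {b : ι → ℝ} {κ m : ℝ} (hb : ∀ j, 0 < b j ∧ b j ≤ 1) (hκ0 : 0 < κ) (hκ1 : κ < 1) (hm : 0 < m)
    (ham : ∀ᵐ x ∂μ, m ≤ a₀ x) (hsum : ∀ᵐ x ∂μ, ∑ j, |φ j x| / b j ≤ 2 * κ * a₀ x) :
    EnergyBound (formOp W ha₀) (fun j => formOp W (hφ j))
      (fun j p => ∫ x, |φ j x| * inner ℝ ((p : Lp F 2 μ) x) ((p : Lp F 2 μ) x) ∂μ) b κ m where
  b_pos j := (hb j).1
  b_le_one j := (hb j).2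
  κ_pos := hκ0
  κ_lt_one := hκ1
  m_pos := hm
  abs_inner_le j p q _ ht := abs_inner_formOp_le W (hφ j) p q ht
  le_inner p := mul_norm_sq_le_inner_formOp W ha₀ ham p
  sum_le p := by
    have hi : ∀ j, Integrable
        (fun x => |φ j x| * inner ℝ ((p : Lp F 2 μ) x) ((p : Lp F 2 μ) x) / b j) μ := fun j =>
      (integrable_mul_inner (hφ j).abs (p : Lp F 2 μ) p).div_const _
    simp only [inner_formOp, ← integral_div]
    rw [← integral_finsetSum _ fun j _ => hi j, ← integral_const_mul]
    refine integral_mono_ae (integrable_finsetSum _ fun j _ => hi j)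
      ((integrable_mul_inner ha₀ _ _).const_mul _) ?_
    filter_upwards [hsum] with x hx
    have h1 := mul_le_mul_of_nonneg_right hx
      (real_inner_self_nonneg (x := ((p : Lp F 2 μ) x)))
    rw [Finset.sum_mul] at h1
    refine le_trans (le_of_eq ?_) (h1.trans (le_of_eq (by ring)))
    exact Finset.sum_congr rfl fun j _ => by ring

end FormOp

/-! ### The coefficient -/

section Coefficient

variable {d : ℕ} {D : TopologicalSpace.Opens (EuclideanSpace ℝ (Fin d))}
  {a₀ : EuclideanSpace ℝ (Fin d) → ℝ} {a₀min : ℝ} {φ : ℕ → EuclideanSpace ℝ (Fin d) → ℝ}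
  {b : ℕ → ℝ} {κ : ℝ}

/-- The essential supremum is taken in `[0, ∞]`, so summability is not presupposed; it follows
almost everywhere because the bound `2 κ a₀` is finite. -/
theorem ae_tsum_le (ha₀min : 0 < a₀min)
    (ha₀ge : ∀ᵐ x ∂volume.restrict (D : Set (EuclideanSpace ℝ (Fin d))), a₀min ≤ a₀ x)
    (hb : ∀ j, 0 < b j ∧ b j ≤ 1)
    (hκ : essSup (fun x => (∑' j, ENNReal.ofReal (|φ j x| / b j)) / ENNReal.ofReal (2 * a₀ x))
      (volume.restrict (D : Set (EuclideanSpace ℝ (Fin d)))) = ENNReal.ofReal κ)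
    (hκ0 : 0 < κ) :
    ∀ᵐ x ∂volume.restrict (D : Set (EuclideanSpace ℝ (Fin d))),
      Summable (fun j => |φ j x| / b j) ∧ ∑' j, |φ j x| / b j ≤ 2 * κ * a₀ x := by
  have h := ENNReal.ae_le_essSup (μ := volume.restrict (D : Set (EuclideanSpace ℝ (Fin d))))
    fun x => (∑' j, ENNReal.ofReal (|φ j x| / b j)) / ENNReal.ofReal (2 * a₀ x)
  rw [hκ] at h
  filter_upwards [h, ha₀ge] with x hx ha
  have ha' : 0 < a₀ x := ha₀min.trans_le ha
  rw [ENNReal.div_le_iff (by simpa using ha') ENNReal.ofReal_ne_top,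
    ← ENNReal.ofReal_mul hκ0.le] at hx
  have hnn : ∀ j, 0 ≤ |φ j x| / b j := fun j => div_nonneg (abs_nonneg _) (hb j).1.le
  have hs : Summable (fun j => |φ j x| / b j) := by
    have := ENNReal.summable_toReal (ne_top_of_le_ne_top ENNReal.ofReal_ne_top hx)
    simpa only [ENNReal.toReal_ofReal (hnn _)] using this
  refine ⟨hs, ?_⟩
  rw [← ENNReal.ofReal_tsum_of_nonneg hnn hs, ENNReal.ofReal_le_ofReal_iff (by positivity)] at hx
  linarith

theorem memLp_top_of_ae_tsum_le
    (ha₀ : MemLp a₀ ⊤ (volume.restrict (D : Set (EuclideanSpace ℝ (Fin d)))))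
    (hφ : ∀ j, AEStronglyMeasurable (φ j)
      (volume.restrict (D : Set (EuclideanSpace ℝ (Fin d)))))
    (hb : ∀ j, 0 < b j ∧ b j ≤ 1) (hκ0 : 0 < κ)
    (hsum : ∀ᵐ x ∂volume.restrict (D : Set (EuclideanSpace ℝ (Fin d))),
      Summable (fun j => |φ j x| / b j) ∧ ∑' j, |φ j x| / b j ≤ 2 * κ * a₀ x) (j : ℕ) :
    MemLp (φ j) ⊤ (volume.restrict (D : Set (EuclideanSpace ℝ (Fin d)))) := by
  refine ha₀.of_le_mul (c := 2 * κ) (hφ j) ?_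
  filter_upwards [hsum] with x hx
  have h1 : |φ j x| / b j ≤ ∑' j, |φ j x| / b j :=
    hx.1.le_tsum j fun i _ => div_nonneg (abs_nonneg _) (hb i).1.le
  have h2 : |φ j x| ≤ |φ j x| / b j := le_div_self (abs_nonneg _) (hb j).1 (hb j).2
  rw [Real.norm_eq_abs, Real.norm_eq_abs]
  refine (h2.trans (h1.trans hx.2)).trans ?_
  exact mul_le_mul_of_nonneg_left (le_abs_self _) (by positivity)

/-- The factor `1/2` from `|y j| ≤ 1/2` cancels the `2` in the normalisation of `κ`, and `b j ≤ 1`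
inserts the weights. -/
theorem coeff_bounds (hb : ∀ j, 0 < b j ∧ b j ≤ 1)
    (hsum : ∀ᵐ x ∂volume.restrict (D : Set (EuclideanSpace ℝ (Fin d))),
      Summable (fun j => |φ j x| / b j) ∧ ∑' j, |φ j x| / b j ≤ 2 * κ * a₀ x)
    {y : ℕ → ℝ} (hy : y ∈ paramDomain) :
    ∀ᵐ x ∂volume.restrict (D : Set (EuclideanSpace ℝ (Fin d))),
      Summable (fun j => y j * φ j x) ∧ |∑' j, y j * φ j x| ≤ κ * a₀ x := by
  filter_upwards [hsum] with x hx
  have h1 : ∀ j, |y j * φ j x| ≤ 1 / 2 * (|φ j x| / b j) := fun j => by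
    rw [abs_mul]
    exact mul_le_mul (abs_le.2 ⟨by linarith [(hy j).1], (hy j).2⟩)
      (le_div_self (abs_nonneg _) (hb j).1 (hb j).2) (abs_nonneg _) (by norm_num)
  have h2 : Summable fun j => |y j * φ j x| :=
    Summable.of_nonneg_of_le (fun _ => abs_nonneg _) h1 (hx.1.mul_left _)
  refine ⟨h2.of_abs, ?_⟩
  have h3 : |∑' j, y j * φ j x| ≤ ∑' j, |y j * φ j x| := by
    simpa using norm_tsum_le_tsum_norm (f := fun j => y j * φ j x) (by simpa using h2)
  refine h3.trans ((h2.tsum_le_tsum h1 (hx.1.mul_left _)).trans ?_)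
  rw [tsum_mul_left]
  linarith [hx.2]

theorem memLp_coeff
    (ha₀ : MemLp a₀ ⊤ (volume.restrict (D : Set (EuclideanSpace ℝ (Fin d)))))
    (hφ : ∀ j, AEStronglyMeasurable (φ j)
      (volume.restrict (D : Set (EuclideanSpace ℝ (Fin d)))))
    (hb : ∀ j, 0 < b j ∧ b j ≤ 1) (hκ0 : 0 < κ)
    (hsum : ∀ᵐ x ∂volume.restrict (D : Set (EuclideanSpace ℝ (Fin d))),
      Summable (fun j => |φ j x| / b j) ∧ ∑' j, |φ j x| / b j ≤ 2 * κ * a₀ x)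
    {y : ℕ → ℝ} (hy : y ∈ paramDomain) :
    MemLp (coeff a₀ φ y) ⊤ (volume.restrict (D : Set (EuclideanSpace ℝ (Fin d)))) := by
  have hc := coeff_bounds hb hsum hy
  have hm : AEStronglyMeasurable (fun x => ∑' j, y j * φ j x)
      (volume.restrict (D : Set (EuclideanSpace ℝ (Fin d)))) := by
    refine aestronglyMeasurable_of_tendsto_ae Filter.atTop
      (f := fun n x => ∑ j ∈ Finset.range n, y j * φ j x) (fun n => ?_) ?_
    · exact Finset.aestronglyMeasurable_fun_sum _ fun j _ => (hφ j).const_mul _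
    · filter_upwards [hc] with x hx
      exact hx.1.hasSum.tendsto_sum_nat
  refine ha₀.add (ha₀.of_le_mul (c := κ) hm ?_)
  filter_upwards [hc] with x hx
  exact hx.2.trans (mul_le_mul_of_nonneg_left (le_abs_self _) hκ0.le)

theorem ae_le_coeff (hb : ∀ j, 0 < b j ∧ b j ≤ 1) (hκ1 : κ < 1)
    (ha₀ge : ∀ᵐ x ∂volume.restrict (D : Set (EuclideanSpace ℝ (Fin d))), a₀min ≤ a₀ x)
    (hsum : ∀ᵐ x ∂volume.restrict (D : Set (EuclideanSpace ℝ (Fin d))),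
      Summable (fun j => |φ j x| / b j) ∧ ∑' j, |φ j x| / b j ≤ 2 * κ * a₀ x)
    {y : ℕ → ℝ} (hy : y ∈ paramDomain) :
    ∀ᵐ x ∂volume.restrict (D : Set (EuclideanSpace ℝ (Fin d))),
      (1 - κ) * a₀min ≤ coeff a₀ φ y x := by
  filter_upwards [coeff_bounds hb hsum hy, ha₀ge] with x hx ha
  have h1 := (abs_le.1 hx.2).1
  have h2 := mul_le_mul_of_nonneg_left ha (show 0 ≤ 1 - κ by linarith)
  unfold coeff
  linarith

theorem zeroExt_mem_paramDomain {s : Finset ℕ} {z : s → ℝ}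
    (hz : ∀ j, z j ∈ Icc (-(1 / 2) : ℝ) (1 / 2)) : zeroExt s z ∈ paramDomain := by
  intro j
  unfold zeroExt
  split_ifs with h
  · exact hz _
  · norm_num

theorem coeff_zeroExt (s : Finset ℕ) (z : s → ℝ) (x : EuclideanSpace ℝ (Fin d)) :
    coeff a₀ φ (zeroExt s z) x = a₀ x + ∑ j : s, z j * φ j x := by
  unfold coeff
  rw [tsum_eq_sum (s := s) fun j hj => by simp [zeroExt, hj], ← Finset.sum_coe_sort]
  congr 1
  refine Finset.sum_congr rfl fun j _ => ?_
  simp [zeroExt]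

theorem indicator_zeroExt (s v : Finset ℕ) (z : s → ℝ) :
    (v : Set ℕ).indicator (zeroExt s z) = zeroExt s (restrictTo v z) := by
  ext j
  by_cases hj : j ∈ v <;> by_cases hs : j ∈ s <;> simp [zeroExt, restrictTo, hj, hs]

end Coefficient

/-! ### The weak formulation on the space of gradients -/

section Weak

variable {d : ℕ} {D : TopologicalSpace.Opens (EuclideanSpace ℝ (Fin d))}

/-- The Riesz representation of a functional on `H₀¹(D)` in the space of gradients. -/
theorem exists_riesz (hinj : Function.Injective (grad D))
    [CompleteSpace (LinearMap.range (grad D))] (f : StrongDual ℝ (H10 D)) :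
    ∃ r : LinearMap.range (grad D), ‖r‖ ≤ ‖f‖ ∧
      ∀ v, f v = inner ℝ r (⟨grad D v, v, rfl⟩ : LinearMap.range (grad D)) := by
  let e := LinearEquiv.ofInjective (grad D) hinj
  have hnorm : ∀ p, ‖e.symm p‖ = ‖p‖ := fun p => by
    -- Definitional: the norm of `H10 D` is induced by `grad`.
    have h1 : ‖e.symm p‖ = ‖grad D (e.symm p)‖ := rfl
    have h2 : grad D (e.symm p) = p := congrArg Subtype.val (e.apply_symm_apply p)
    rw [h1, h2]
    rfl
  let g : StrongDual ℝ (LinearMap.range (grad D)) :=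
    (f.toLinearMap.comp e.symm.toLinearMap).mkContinuous ‖f‖ fun p => by
      rw [← hnorm p]
      exact f.le_opNorm _
  refine ⟨(InnerProductSpace.toDual ℝ _).symm g, ?_, fun v => ?_⟩
  · rw [LinearIsometryEquiv.norm_map]
    exact LinearMap.mkContinuous_norm_le _ (norm_nonneg _) _
  · rw [InnerProductSpace.toDual_symm_apply]
    show f v = f (e.symm (e v))
    rw [e.symm_apply_apply]

theorem isWeakSolution_iff [CompleteSpace (LinearMap.range (grad D))]
    {a₀ : EuclideanSpace ℝ (Fin d) → ℝ} {φ : ℕ → EuclideanSpace ℝ (Fin d) → ℝ}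
    {f : StrongDual ℝ (H10 D)} {r : LinearMap.range (grad D)}
    (hr : ∀ v, f v = inner ℝ r (⟨grad D v, v, rfl⟩ : LinearMap.range (grad D)))
    {y : ℕ → ℝ}
    (hy : MemLp (coeff a₀ φ y) ⊤ (volume.restrict (D : Set (EuclideanSpace ℝ (Fin d)))))
    (w : H10 D) :
    IsWeakSolution D a₀ φ f y w ↔
      formOp (LinearMap.range (grad D)) hy ⟨grad D w, w, rfl⟩ = r := by
  constructor
  · intro h
    refine ext_inner_right ℝ fun q => ?_
    obtain ⟨_, v, rfl⟩ := q
    rw [inner_formOp, ← hr]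
    exact h v
  · intro h v
    rw [hr, ← h, inner_formOp]

/-- Lax–Milgram is applied on the space of gradients; injectivity of the gradient carries uniqueness
back to `H10 D`. -/
theorem existsUnique_isWeakSolution (hinj : Function.Injective (grad D))
    [CompleteSpace (LinearMap.range (grad D))]
    {a₀ : EuclideanSpace ℝ (Fin d) → ℝ} {φ : ℕ → EuclideanSpace ℝ (Fin d) → ℝ}
    (f : StrongDual ℝ (H10 D)) {y : ℕ → ℝ}
    (hy : MemLp (coeff a₀ φ y) ⊤ (volume.restrict (D : Set (EuclideanSpace ℝ (Fin d)))))
    {c : ℝ} (hc : 0 < c)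
    (hcy : ∀ᵐ x ∂volume.restrict (D : Set (EuclideanSpace ℝ (Fin d))), c ≤ coeff a₀ φ y x) :
    ∃! w : H10 D, IsWeakSolution D a₀ φ f y w := by
  obtain ⟨r, -, hr⟩ := exists_riesz hinj f
  have hbij := ContinuousLinearMap.isUnit_iff_bijective.1 (isUnit_of_coercive hc
    (mul_norm_sq_le_inner_formOp (LinearMap.range (grad D)) hy hcy))
  simp only [isWeakSolution_iff hr hy]
  obtain ⟨⟨_, w, rfl⟩, hw⟩ := hbij.2 r
  exact ⟨w, hw, fun w' hw' => hinj (congrArg Subtype.val (hbij.1 (hw'.trans hw.symm)))⟩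

/-- On finitely many parameters the operator of the problem is an affine family. -/
theorem formOp_coeff_zeroExt [CompleteSpace (LinearMap.range (grad D))]
    {a₀ : EuclideanSpace ℝ (Fin d) → ℝ} {φ : ℕ → EuclideanSpace ℝ (Fin d) → ℝ} {s : Finset ℕ}
    (ha₀ : MemLp a₀ ⊤ (volume.restrict (D : Set (EuclideanSpace ℝ (Fin d)))))
    (hφ : ∀ j : s, MemLp (φ j) ⊤ (volume.restrict (D : Set (EuclideanSpace ℝ (Fin d)))))
    {z : s → ℝ}
    (hy : MemLp (coeff a₀ φ (zeroExt s z)) ⊤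
      (volume.restrict (D : Set (EuclideanSpace ℝ (Fin d))))) :
    formOp (LinearMap.range (grad D)) hy = affineOp (formOp (LinearMap.range (grad D)) ha₀)
      (fun j => formOp (LinearMap.range (grad D)) (hφ j)) z := by
  ext1 p
  refine ext_inner_right ℝ fun q => ?_
  have h1 : ∀ j : s, Integrable (fun x => z j * (φ j x * inner ℝ
      ((p : L2 D (EuclideanSpace ℝ (Fin d))) x) ((q : L2 D (EuclideanSpace ℝ (Fin d))) x)))
      (volume.restrict (D : Set (EuclideanSpace ℝ (Fin d)))) := fun j =>
    (integrable_mul_inner (hφ j) _ _).const_mul _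
  have h2 : inner ℝ (affineOp (formOp (LinearMap.range (grad D)) ha₀)
      (fun j => formOp (LinearMap.range (grad D)) (hφ j)) z p) q =
      inner ℝ (formOp (LinearMap.range (grad D)) ha₀ p) q +
        ∑ j, z j * inner ℝ (formOp (LinearMap.range (grad D)) (hφ j) p) q := by
    simp [affineOp, inner_add_left, sum_inner, real_inner_smul_left]
  rw [h2]
  simp only [inner_formOp, ← integral_const_mul]
  rw [← integral_finsetSum _ fun j _ => h1 j, ← integral_add (integrable_mul_inner ha₀ _ _)
    (integrable_finsetSum _ fun j _ => h1 j)]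
  refine integral_congr_ae (Filter.Eventually.of_forall fun x => ?_)
  simp only [coeff_zeroExt, add_mul, Finset.sum_mul, mul_assoc]

end Weak

/-! ### The anchored terms of a functional of the solution -/

section Functional

variable {W : Type*} [NormedAddCommGroup W] [InnerProductSpace ℝ W] [CompleteSpace W]
  {s : Finset ℕ} {A₀ : W →L[ℝ] W} {A : s → W →L[ℝ] W} {Q : s → W → ℝ} {b : ℕ → ℝ} {κ m : ℝ}

theorem EnergyBound.hasDerivAt_inner_solDeriv (h : EnergyBound A₀ A Q (fun j => b j) κ m)
    (f g : W) (ν : s → ℕ) (z : s → ℝ) (j : s) (hz : ∀ i, z i ∈ Icc (-(1 / 2) : ℝ) (1 / 2)) :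
    HasDerivAt (fun t => inner ℝ g (solDeriv A₀ A f ν (Function.update z j t)))
      (inner ℝ g (solDeriv A₀ A f (Function.update ν j (ν j + 1)) z)) (z j) :=
  (innerSL ℝ g).hasFDerivAt.comp_hasDerivAt (z j) (hasDerivAt_solDeriv (h.isUnit hz) ν j)

theorem EnergyBound.continuousAt_inner_solDeriv (h : EnergyBound A₀ A Q (fun j => b j) κ m)
    (f g : W) (ν : s → ℕ) (z : s → ℝ) (hz : ∀ i, z i ∈ Icc (-(1 / 2) : ℝ) (1 / 2)) :
    ContinuousAt (fun z => inner ℝ g (solDeriv A₀ A f ν z)) z :=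
  (innerSL ℝ g).continuous.continuousAt.comp (continuousAt_solDeriv (h.isUnit hz) ν)

/-- Orders at least `1` together with `b j ≤ 1` give `b j ^ ν j ≤ b j`; this is the source of the
weight `∏ b j`. -/
theorem EnergyBound.abs_inner_solDeriv_le (h : EnergyBound A₀ A Q (fun j => b j) κ m)
    (f g : W) (ν : s → ℕ) (z : s → ℝ) (hν : ∀ j, ν j ≠ 0)
    (hz : ∀ i, z i ∈ Icc (-(1 / 2) : ℝ) (1 / 2)) {Nf Ng : ℝ} (hf : ‖f‖ ≤ Nf) (hg : ‖g‖ ≤ Ng) :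
    |inner ℝ g (solDeriv A₀ A f ν z)| ≤ Nf * Ng / ((1 - κ) * m) * (∏ j ∈ s, b j) *
      ∏ j, (((ν j).factorial : ℝ) * (2 * (κ / (1 - κ))) ^ ν j) := by
  have h1κ : 0 < 1 - κ := by linarith [h.κ_lt_one]
  have hκ := h.κ_pos
  have hm := h.m_pos
  have hb : ∏ j : s, b j ^ ν j ≤ ∏ j ∈ s, b j := by
    rw [← Finset.prod_coe_sort s b]
    exact Finset.prod_le_prod (fun j _ => pow_nonneg (h.b_pos j).le _) fun j _ =>
      pow_le_of_le_one (h.b_pos j).le (h.b_le_one j) (hν j)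
  have hNf : 0 ≤ Nf := (norm_nonneg _).trans hf
  have hNg : 0 ≤ Ng := (norm_nonneg _).trans hg
  have hc : 0 ≤ ∏ j, (((ν j).factorial : ℝ) * (2 * (κ / (1 - κ))) ^ ν j) :=
    Finset.prod_nonneg fun _ _ => by positivity
  calc |inner ℝ g (solDeriv A₀ A f ν z)| ≤ ‖g‖ * ‖solDeriv A₀ A f ν z‖ :=
        abs_real_inner_le_norm _ _
    _ ≤ Ng * (‖f‖ / ((1 - κ) * m) *
          ∏ j, (((ν j).factorial : ℝ) * b j ^ ν j * (2 * (κ / (1 - κ))) ^ ν j)) :=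
        mul_le_mul hg (h.norm_solDeriv_le hz f ν) (norm_nonneg _) hNg
    _ = Ng * (‖f‖ / ((1 - κ) * m) * ((∏ j : s, b j ^ ν j) *
          ∏ j, (((ν j).factorial : ℝ) * (2 * (κ / (1 - κ))) ^ ν j))) := by
        rw [← Finset.prod_mul_distrib]
        congr 2
        exact Finset.prod_congr rfl fun j _ => by ring
    _ ≤ Ng * (Nf / ((1 - κ) * m) * ((∏ j ∈ s, b j) *
          ∏ j, (((ν j).factorial : ℝ) * (2 * (κ / (1 - κ))) ^ ν j))) := by
        have hb0 : 0 ≤ ∏ j : s, b j ^ ν j :=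
          Finset.prod_nonneg fun j _ => pow_nonneg (h.b_pos j).le _
        gcongr
    _ = _ := by ring

theorem EnergyBound.contDiffAt_anchoredFamily (h : EnergyBound A₀ A Q (fun j => b j) κ m)
    (f g : W) (z : s → ℝ) (hz : ∀ i, z i ∈ Icc (-(1 / 2) : ℝ) (1 / 2)) :
    ContDiffAt ℝ ∞ (anchoredFamily (fun ν z => inner ℝ g (solDeriv A₀ A f ν z)) 0) z := by
  unfold anchoredFamily
  refine ContDiffAt.sum fun v _ => contDiffAt_const.mul ?_
  simp only [Pi.zero_apply, ne_eq, not_true_eq_false, false_imp_iff, implies_true, if_true]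
  refine contDiffAt_const.inner ℝ ?_
  exact ContDiffAt.comp (g := solDeriv A₀ A f 0) z
    (contDiffAt_solDeriv_zero (h.isUnit (restrictTo_mem hz))) (contDiff_restrictTo v).contDiffAt

end Functional

end ParamPDE
end

/-! ### The theorem -/

open ParamPDE
theorem lemma5p5 {d : ℕ} (hd : 0 < d)
    (D : TopologicalSpace.Opens (EuclideanSpace ℝ (Fin d)))
    (hD : Bornology.IsBounded (D : Set (EuclideanSpace ℝ (Fin d))))
    (a₀ : EuclideanSpace ℝ (Fin d) → ℝ) (a₀min : ℝ) (φ : ℕ → EuclideanSpace ℝ (Fin d) → ℝ)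
    (b : ℕ → ℝ) (κ : ℝ) (α : ℕ)
    (ha₀ : MemLp a₀ ⊤ (volume.restrict (D : Set (EuclideanSpace ℝ (Fin d)))))
    (ha₀min : 0 < a₀min)
    (ha₀ge : ∀ᵐ x ∂volume.restrict (D : Set (EuclideanSpace ℝ (Fin d))), a₀min ≤ a₀ x)
    (hφ : ∀ j, AEStronglyMeasurable (φ j)
      (volume.restrict (D : Set (EuclideanSpace ℝ (Fin d)))))
    (hb : ∀ j, 0 < b j ∧ b j ≤ 1)
    (hκ : essSup (fun x => (∑' j, ENNReal.ofReal (|φ j x| / b j)) / ENNReal.ofReal (2 * a₀ x))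
      (volume.restrict (D : Set (EuclideanSpace ℝ (Fin d)))) = ENNReal.ofReal κ)
    (hκ0 : 0 < κ) (hα : 1 ≤ α) (hκα : κ < 1 / (2 * α + 1))
    (f G : StrongDual ℝ (H10 D)) :
    (∀ y ∈ paramDomain, ∃! w : H10 D, IsWeakSolution D a₀ φ f y w) ∧
    ∀ u : (ℕ → ℝ) → H10 D, (∀ y ∈ paramDomain, IsWeakSolution D a₀ φ f y (u y)) →
      ∃ F : ∀ s : Finset ℕ, AnchoredRKHS α s,
        (∀ (s : Finset ℕ) (z : Cube s),
          F s z = G (anchoredTerm u s (zeroExt s fun j => (z j : ℝ)))) ∧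
        (∀ s : Finset ℕ, s.Nonempty →
          ‖F s‖ ≤ √(normConst κ α) * ‖f‖ * ‖G‖ / ((1 - κ) * a₀min) * ∏ j ∈ s, b j) ∧
        (∀ s : Finset ℕ,
          ContDiffOn ℝ ∞ (fun z : s → ℝ => G (anchoredTerm u s (zeroExt s z)))
            (Set.univ.pi fun _ => Set.Icc (-(1 / 2) : ℝ) (1 / 2))) ∧
        (∀ s : Finset ℕ, s.Nonempty →
          √(sobolevSq α fun z : s → ℝ => G (anchoredTerm u s (zeroExt s z))) ≤
            √(normConst κ α) * ‖f‖ * ‖G‖ / ((1 - κ) * a₀min) * ∏ j ∈ s, b j) ∧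
        BddAbove (Set.range fun s : Finset ℕ => (∏ j ∈ s, b j)⁻¹ * ‖F s‖) := by
  have hα1 : (1 : ℝ) ≤ α := by exact_mod_cast hα
  have hκ1 : κ < 1 := hκα.trans_le ((div_le_one (by positivity)).2 (by linarith))
  have h1κ : 0 < 1 - κ := by linarith
  have hsum := ae_tsum_le ha₀min ha₀ge hb hκ hκ0
  have hinj := grad_injective hd hD
  have hcomp : CompleteSpace (LinearMap.range (grad D)) :=
    (isClosed_range_grad hd hD).completeSpace_coe
  have hcoeff : ∀ y ∈ paramDomain, MemLp (coeff a₀ φ y) ⊤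
      (volume.restrict (D : Set (EuclideanSpace ℝ (Fin d)))) := fun y hy =>
    memLp_coeff ha₀ hφ hb hκ0 hsum hy
  have hcoer : ∀ y ∈ paramDomain, ∀ᵐ x ∂volume.restrict (D : Set (EuclideanSpace ℝ (Fin d))),
      (1 - κ) * a₀min ≤ coeff a₀ φ y x := fun y hy => ae_le_coeff hb hκ1 ha₀ge hsum hy
  refine ⟨fun y hy => existsUnique_isWeakSolution hinj f (hcoeff y hy) (mul_pos h1κ ha₀min)
    (hcoer y hy), fun u hu => ?_⟩
  obtain ⟨rf, hrf, hrf'⟩ := exists_riesz hinj f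
  obtain ⟨rG, hrG, hrG'⟩ := exists_riesz hinj G
  have hφtop := memLp_top_of_ae_tsum_le ha₀ hφ hb hκ0 hsum
  let A₀ := formOp (LinearMap.range (grad D)) ha₀
  let A : ∀ s : Finset ℕ, s → LinearMap.range (grad D) →L[ℝ] LinearMap.range (grad D) :=
    fun s j => formOp (LinearMap.range (grad D)) (hφtop j)
  have hEB := fun s : Finset ℕ => energyBound_formOp (LinearMap.range (grad D)) ha₀
    (φ := fun j : s => φ j) (fun j => hφtop j) (b := fun j => b j) (fun j => hb j) hκ0 hκ1 ha₀min
    ha₀ge (by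
      filter_upwards [hsum] with x hx
      refine le_trans ?_ hx.2
      rw [Finset.sum_coe_sort s fun j => |φ j x| / b j]
      exact hx.1.sum_le_tsum s fun j _ => div_nonneg (abs_nonneg _) (hb j).1.le)
  let E : ∀ s : Finset ℕ, (s → ℕ) → (s → ℝ) → ℝ :=
    fun s ν z => inner ℝ rG (solDeriv A₀ (A s) rf ν z)
  -- Any given solution map agrees on the cube with the inverse of the affine family applied to
  -- `rf`, by injectivity of the operator.
  have hu' : ∀ (s : Finset ℕ) (z : s → ℝ), (∀ j, z j ∈ Set.Icc (-(1 / 2) : ℝ) (1 / 2)) →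
      G (u (zeroExt s z)) = E s 0 z := by
    intro s z hz
    have hy := zeroExt_mem_paramDomain hz
    have h1 := (isWeakSolution_iff hrf' (hcoeff _ hy) _).1 (hu _ hy)
    rw [formOp_coeff_zeroExt ha₀ (fun j => hφtop j)] at h1
    have h2 := (hEB s).affineOp_solDeriv_zero hz rf
    have h3 := (ContinuousLinearMap.isUnit_iff_bijective.1 ((hEB s).isUnit hz)).1 (h1.trans h2.symm)
    rw [hrG', h3]
  have hanch : ∀ (s : Finset ℕ) (z : s → ℝ), (∀ j, z j ∈ Set.Icc (-(1 / 2) : ℝ) (1 / 2)) →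
      G (anchoredTerm u s (zeroExt s z)) = anchoredFamily (E s) 0 z := by
    intro s z hz
    simp only [anchoredTerm, map_sum, map_smul, indicator_zeroExt]
    refine Finset.sum_congr rfl fun v _ => ?_
    rw [hu' s _ (restrictTo_mem hz)]
    simp
  let M : Finset ℕ → ℝ := fun s => ‖f‖ * ‖G‖ / ((1 - κ) * a₀min) * ∏ j ∈ s, b j
  have hM : ∀ s, 0 ≤ M s := fun s =>
    mul_nonneg (by positivity) (Finset.prod_nonneg fun j _ => (hb j).1.le)
  let c : ℕ → ℝ := fun r => (r.factorial : ℝ) * (2 * (κ / (1 - κ))) ^ r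
  have hE : ∀ (s : Finset ℕ) (ν : s → ℕ) (z : s → ℝ) (j : s),
      (∀ i, z i ∈ Set.Icc (-(1 / 2) : ℝ) (1 / 2)) →
      HasDerivAt (fun t => E s ν (Function.update z j t))
        (E s (Function.update ν j (ν j + 1)) z) (z j) := fun s =>
    (hEB s).hasDerivAt_inner_solDeriv (b := b) rf rG
  have hbd : ∀ (s : Finset ℕ) (ν : s → ℕ) (z : s → ℝ), (∀ j, ν j ∈ Finset.Icc 1 α) →
      (∀ i, z i ∈ Set.Icc (-(1 / 2) : ℝ) (1 / 2)) → |E s ν z| ≤ M s * ∏ j, c (ν j) :=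
    fun s ν z hν hz => (hEB s).abs_inner_solDeriv_le (b := b) rf rG ν z
      (fun j => Nat.one_le_iff_ne_zero.1 (Finset.mem_Icc.1 (hν j)).1) hz hrf hrG
  have hfinal : ∀ s : Finset ℕ, s.Nonempty →
      M s * √((∑ r ∈ Finset.Icc 1 α, c r ^ 2) ^ s.card) ≤
        √(normConst κ α) * ‖f‖ * ‖G‖ / ((1 - κ) * a₀min) * ∏ j ∈ s, b j := fun s hs => by
    refine (mul_le_mul_of_nonneg_left (Real.sqrt_le_sqrt
      (sum_sq_pow_le_normConst hα hκ0 hκα hs.card_pos.ne')) (hM s)).trans (le_of_eq ?_)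
    simp only [M]
    ring
  choose F hF hFn using fun s => exists_anchoredRKHS_of_family hα s (hE s)
    ((hEB s).continuousAt_inner_solDeriv (b := b) rf rG) (M s) (hM s) c (hbd s)
  refine ⟨F, fun s z => ?_, fun s hs => (hFn s).trans (hfinal s hs), fun s => ?_, fun s hs => ?_, ?_⟩
  · rw [hF, hanch s _ fun j => (z j).2]
  · refine ContDiffOn.congr (f := anchoredFamily (E s) 0) (fun z hz => ?_) fun z hz =>
      hanch s z fun j => hz j (Set.mem_univ j)
    exact ((hEB s).contDiffAt_anchoredFamily (b := b) rf rG z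
      fun j => hz j (Set.mem_univ j)).contDiffWithinAt
  · refine le_trans ?_ (hfinal s hs)
    refine (Real.sqrt_le_sqrt (sobolevSq_anchored_le hα s (hE s) (M s) c (hbd s) (hanch s))).trans ?_
    rw [Real.sqrt_mul (sq_nonneg _), Real.sqrt_sq (hM s)]
  -- The empty set is not covered by the norm bound, so its contribution enters the supremum
  -- separately.
  · refine ⟨max ‖F ∅‖ (√(normConst κ α) * ‖f‖ * ‖G‖ / ((1 - κ) * a₀min)), ?_⟩
    rintro _ ⟨s, rfl⟩
    rcases s.eq_empty_or_nonempty with rfl | hs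
    · simp
    · refine le_max_of_le_right ?_
      have hpos : 0 < ∏ j ∈ s, b j := Finset.prod_pos fun j _ => (hb j).1
      show (∏ j ∈ s, b j)⁻¹ * ‖F s‖ ≤ _
      rw [inv_mul_le_iff₀ hpos, mul_comm (∏ j ∈ s, b j)]
      exact (hFn s).trans (hfinal s hs)
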